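/- Let $n\ge 1$, let $d_1,\dots,d_n\in(0,1)$, $D=\mathrm{Diag}(d_1,\dots,d_n)$, and let $Y_1,Y_2$ be random vectors in $\mathbb{R}^n$, on a probability space, with $(Y_1,Y_2)\in G(0,Q)$, $Q=\begin{pmatrix} I & D\\ D& I\end{pmatrix}$, where $G(0,Q)$ denotes the Gaussian measure with mean zero and variance matrix $Q$. For a joint law of a triple $(Y_1,Y_2,W)$ with $W$ taking values in $\mathbb{R}^m$, call it Gaussian conditionally independent (CIG) if $(Y_1,Y_2,W)$ is jointly Gaussian and $Y_1,Y_2$ are conditionally independent given the $\sigma$-algebra generated by $W$; call it minimal if no CIG law with the same $(Y_1,Y_2)$-marginal and a smaller dimension of $W$ exists. Define Wyner's common information $C(Y_1,Y_2)=\inf I(Y_1,Y_2;W)\in[0,\infty]$, where the infimum is over all dimensions $m$ and all CIG laws of $(Y_1,Y_2,W)$ whose $(Y_1,Y_2)$-marginal is the given law, and $I$ is mutual information in nats. Let $\mathbf{Q_W}$ be the set of symmetric $Q_W\in\mathbb{R}^{n\times n}$ with $0<D\le Q_W\le D^{-1}$ (Loewner order), let $$Q_s(Q_W)=\begin{pmatrix}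 I & D & D^{1/2}\\ D & I & D^{1/2}Q_W\\ D^{1/2} & Q_W D^{1/2} & Q_W\end{pmatrix},$$ and let $\mathbf{P_{ci}}=\{G(0,Q_s(Q_W)) : Q_W\in\mathbf{Q_W}\}$. Then the following hold. (a) $$C(Y_1,Y_2)=\frac12\sum_{i=1}^n\ln\frac{1+d_i}{1-d_i}=\frac12\sum_{i=1}^n\ln\Bigl(1+\frac{2d_i}{1-d_i}\Bigr)\in(0,\infty).$$ Moreover every member of $\mathbf{P_{ci}}$ is a minimal CIG law with the given $(Y_1,Y_2)$-marginal, and the minimum of $I(Y_1,Y_2;W)$ over $\mathbf{P_{ci}}$ equals $C(Y_1,Y_2)$ and is attained at $Q_W=I$ and at no other $Q_W\in\mathbf{Q_W}$. (b) Let $L_1=L_2=D^{1/2}(I+D)^{-1}$ and $L_3=(I-D)^{1/2}(I+D)^{-1/2}$, which are diagonal matrices. Let $V\in G(0,I)$ be a random vector in $\mathbb{R}^n$ on the same probability space such that the $\sigma$-algebra $F^V$ is independent of $F^{Y_1}\vee F^{Y_2}$, and put $W^*=L_1Y_1+L_2Y_2+L_3V$ and $Z_i=Y_i-D^{1/2}W^*$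 for $i=1,2$. (Some probability space carries such $Y_1,Y_2,V$.) Then $Z_1,Z_2\in G(0,I-D)$, $W^*\in G(0,I)$, the random vectors $Z_1,Z_2,W^*$ are independent, $Y_i=D^{1/2}W^*+Z_i$ for $i=1,2$, and each of $V,Z_1,Z_2,W^*$ has independent components. The law of $(Y_1,Y_2,W^*)$ is $G(0,Q_s(I))$; it belongs to $\mathbf{P_{ci}}$ and is a minimal CIG law. (c) $C(Y_1,Y_2)=I(Y_1,Y_2;W^*)$. -/

import Mathlib

open MeasureTheory ProbabilityTheory
open scoped ENNReal Matrix

noncomputable section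

namespace GaussianCI

/-- Column vectors with entries indexed by `ι`. -/
abbrev Vec (ι : Type*) := EuclideanSpace ℝ ι

/-- The stacked vector `(x, y)`. -/
def stack {ι κ : Type*} (x : Vec ι) (y : Vec κ) : Vec (ι ⊕ κ) :=
  WithLp.toLp 2 (Sum.elim x y)

/-- The first block of a stacked vector. -/
def fstBlock {ι κ : Type*} (z : Vec (ι ⊕ κ)) : Vec ι :=
  WithLp.toLp 2 (fun i => z (Sum.inl i))

/-- The second block of a stacked vector. -/
def sndBlock {ι κ : Type*} (z : Vec (ι ⊕ κ)) : Vec κ :=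
  WithLp.toLp 2 (fun j => z (Sum.inr j))

theorem measurable_fstBlock {ι κ : Type*} [Fintype ι] [Fintype κ] :
    Measurable (fstBlock : Vec (ι ⊕ κ) → Vec ι) := by
  unfold fstBlock
  fun_prop

theorem measurable_sndBlock {ι κ : Type*} [Fintype ι] [Fintype κ] :
    Measurable (sndBlock : Vec (ι ⊕ κ) → Vec κ) := by
  unfold sndBlock
  fun_prop

/-- `X ∈ G(0, Q)`: under `P`, the random vector `X` is Gaussian with mean zero and
variance matrix `Q`. -/
def IsG0 {Ω ι : Type*} [MeasurableSpace Ω] [Fintype ι] [DecidableEq ι]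
    (X : Ω → Vec ι) (Q : Matrix ι ι ℝ) (P : Measure Ω) : Prop :=
  Q.PosSemidef ∧ HasLaw X (multivariateGaussian 0 Q) P

/-- The mutual information `I(X; Y)` in nats: the Kullback-Leibler divergence of the joint law
from the product of the marginal laws. -/
def mutualInfo {Ω α β : Type*} [MeasurableSpace Ω] [MeasurableSpace α] [MeasurableSpace β]
    (X : Ω → α) (Y : Ω → β) (P : Measure Ω) : ℝ≥0∞ :=
  InformationTheory.klDiv (P.map (fun ω => (X ω, Y ω))) ((P.map X).prod (P.map Y))

section CommonInformation

variable {ι₁ ι₂ κ : Type*} [Fintype ι₁] [Fintype ι₂] [Fintype κ]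

/-- Under the law `μ` of a triple `(Y₁, Y₂, W)`, the triple is jointly Gaussian and `Y₁`, `Y₂`
are conditionally independent given (the σ-algebra generated by) `W`. -/
structure IsCIG (μ : Measure (Vec ((ι₁ ⊕ ι₂) ⊕ κ))) : Prop where
  gaussian : IsGaussian μ
  condIndep :
    CondIndepFun (MeasurableSpace.comap (sndBlock : Vec ((ι₁ ⊕ ι₂) ⊕ κ) → Vec κ) inferInstance)
      measurable_sndBlock.comap_le
      (fun z => fstBlock (fstBlock z)) (fun z => sndBlock (fstBlock z)) μ

/-- The laws of triples `(Y₁, Y₂, W)`, with `W` of dimension `m`, that are Gaussian conditionally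
independent and have `ν` as the marginal law of `(Y₁, Y₂)`. -/
def PCIG (ν : Measure (Vec (ι₁ ⊕ ι₂))) (m : ℕ) : Set (Measure (Vec ((ι₁ ⊕ ι₂) ⊕ Fin m))) :=
  {μ | IsCIG μ ∧ μ.map fstBlock = ν}

/-- The members of `PCIG ν m` for which the dimension `m` of `W` is minimal. -/
def PCIGmin (ν : Measure (Vec (ι₁ ⊕ ι₂))) (m : ℕ) : Set (Measure (Vec ((ι₁ ⊕ ι₂) ⊕ Fin m))) :=
  {μ | μ ∈ PCIG ν m ∧ ∀ m₁ < m, ¬ ∃ μ₁, μ₁ ∈ PCIG ν m₁}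

/-- `I(Y₁, Y₂; W)` for a triple `(Y₁, Y₂, W)` with law `μ`. -/
def tripleInfo (μ : Measure (Vec ((ι₁ ⊕ ι₂) ⊕ κ))) : ℝ≥0∞ :=
  mutualInfo fstBlock sndBlock μ

/-- Wyner's common information (information definition) of a Gaussian pair with law `ν`: the
infimum of `I(Y₁, Y₂; W)` over all Gaussian conditionally independent triples of any dimension
of `W`, with values in `[0, ∞]`. -/
def wynerCLaw (ν : Measure (Vec (ι₁ ⊕ ι₂))) : ℝ≥0∞ :=
  ⨅ (m : ℕ) (μ ∈ PCIG ν m), tripleInfo μ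

/-- Wyner's common information `C(Y₁, Y₂)`. -/
def wynerC {Ω : Type*} [MeasurableSpace Ω] (Y₁ : Ω → Vec ι₁) (Y₂ : Ω → Vec ι₂)
    (P : Measure Ω) : ℝ≥0∞ :=
  wynerCLaw (P.map (fun ω => stack (Y₁ ω) (Y₂ ω)))

end CommonInformation

section Correlated

variable {n : ℕ}

/-- The variance matrix `[[I, D], [D, I]]` with `D = Diag(d)`. -/
def Qcorr (d : Fin n → ℝ) : Matrix (Fin n ⊕ Fin n) (Fin n ⊕ Fin n) ℝ :=
  Matrix.fromBlocks 1 (Matrix.diagonal d) (Matrix.diagonal d) 1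

/-- The nonnegative square root of the diagonal matrix `Diag(d)` (for `d ≥ 0`). -/
def diagSqrt (d : Fin n → ℝ) : Matrix (Fin n) (Fin n) ℝ :=
  Matrix.diagonal (fun i => √(d i))

/-- The variance matrix
`[[I, D, D^{1/2}], [D, I, D^{1/2} Q], [D^{1/2}, Q D^{1/2}, Q]]` of a triple `(Y₁, Y₂, W)`. -/
def Qs (d : Fin n → ℝ) (Q : Matrix (Fin n) (Fin n) ℝ) :
    Matrix ((Fin n ⊕ Fin n) ⊕ Fin n) ((Fin n ⊕ Fin n) ⊕ Fin n) ℝ :=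
  Matrix.fromBlocks (Qcorr d)
    (Matrix.fromRows (diagSqrt d) (diagSqrt d * Q))
    (Matrix.fromCols (diagSqrt d) (Q * diagSqrt d)) Q

/-- The symmetric matrices `Q` with `0 < D ≤ Q ≤ D⁻¹` in the Loewner order. -/
def QWset (d : Fin n → ℝ) : Set (Matrix (Fin n) (Fin n) ℝ) :=
  {Q | Q.IsSymm ∧ (Matrix.diagonal d).PosDef ∧ (Q - Matrix.diagonal d).PosSemidef ∧
    ((Matrix.diagonal d)⁻¹ - Q).PosSemidef}

/-- The Gaussian measure `G(0, Qs(Q))`. -/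
def gaussQs (d : Fin n → ℝ) (Q : Matrix (Fin n) (Fin n) ℝ) :
    Measure (Vec ((Fin n ⊕ Fin n) ⊕ Fin n)) :=
  multivariateGaussian 0 (Qs d Q)

/-- The family of Gaussian measures `G(0, Qs(Q))` parametrized by `Q ∈ QWset d`. -/
def Pci (d : Fin n → ℝ) : Set (Measure (Vec ((Fin n ⊕ Fin n) ⊕ Fin n))) :=
  {μ | ∃ Q ∈ QWset d, μ = gaussQs d Q}

/-- `L₁ = L₂ = D^{1/2} (I + D)⁻¹`. -/
def L12 (d : Fin n → ℝ) : Matrix (Fin n) (Fin n) ℝ :=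
  diagSqrt d * (1 + Matrix.diagonal d)⁻¹

/-- `L₃ = (I - D)^{1/2} (I + D)^{-1/2}`. -/
def L3 (d : Fin n → ℝ) : Matrix (Fin n) (Fin n) ℝ :=
  diagSqrt (fun i => 1 - d i) * (diagSqrt (fun i => 1 + d i))⁻¹

/-- The product of a matrix and a column vector. -/
def app (A : Matrix (Fin n) (Fin n) ℝ) (x : Vec (Fin n)) : Vec (Fin n) :=
  WithLp.toLp 2 (A *ᵥ x.ofLp)

variable {Ω : Type*}

/-- `W* = L₁ Y₁ + L₂ Y₂ + L₃ V`. -/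
def Wstar (d : Fin n → ℝ) (Y₁ Y₂ V : Ω → Vec (Fin n)) (ω : Ω) : Vec (Fin n) :=
  app (L12 d) (Y₁ ω) + app (L12 d) (Y₂ ω) + app (L3 d) (V ω)

/-- `Z = Y - D^{1/2} W`. -/
def resid (d : Fin n → ℝ) (Y W : Ω → Vec (Fin n)) (ω : Ω) : Vec (Fin n) :=
  Y ω - app (diagSqrt d) (W ω)

variable [MeasurableSpace Ω]

/-- `Y₁`, `Y₂` are random vectors with `(Y₁, Y₂) ∈ G(0, [[I, D], [D, I]])`. -/
structure IsCorrPair (d : Fin n → ℝ) (Y₁ Y₂ : Ω → Vec (Fin n)) (P : Measure Ω) : Prop where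
  meas₁ : Measurable Y₁
  meas₂ : Measurable Y₂
  law : IsG0 (fun ω => stack (Y₁ ω) (Y₂ ω)) (Qcorr d) P

/-- `V ∈ G(0, I)` is a random vector such that `F^V` and `F^{Y₁} ∨ F^{Y₂}` are independent. -/
structure IsExtraNoise (Y₁ Y₂ V : Ω → Vec (Fin n)) (P : Measure Ω) : Prop where
  meas : Measurable V
  law : IsG0 V 1 P
  indep : Indep (MeasurableSpace.comap V inferInstance)
    (MeasurableSpace.comap Y₁ inferInstance ⊔ MeasurableSpace.comap Y₂ inferInstance) P

/-- The entries of the random vector `X` are independent. -/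
def HasIndepComponents (X : Ω → Vec (Fin n)) (P : Measure Ω) : Prop :=
  iIndepFun (fun (i : Fin n) (ω : Ω) => X ω i) P

end Correlated

end GaussianCI

end

open GaussianCI

/-!
Write `A = Y₁ + Y₂`, whose entries are independent Gaussians of variances `2 (1 + dᵢ)`.

**Lower bound.** For a Gaussian conditionally independent triple let `U₁`, `U₂` be the conditional
means of `Y₁`, `Y₂` given `W`. The Donsker–Varadhan inequality
(`ofReal_integral_le_klDiv`) bounds `I(A; W)`, hence `I(Y₁, Y₂; W)`, from below by the expectation of
any `f(A, W)` for which `exp f` has integral one under the product of the marginals. Take for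
`f` the sum over `i` of the logarithms of the density of `N(U₁ᵢ + U₂ᵢ, 2 (1 - dᵢ))` with respect to
`N(0, 2 (1 + dᵢ))`. Conditional independence enters only through `E[U₁ᵢ U₂ᵢ] = E[Y₁ᵢ Y₂ᵢ] = dᵢ`, and
a computation of second moments (`sum_log_le_mutualInfo`) gives

`I(Y₁, Y₂; W) ≥ ∑ᵢ (1/2 log ((1 + dᵢ)/(1 - dᵢ)) + E (U₁ᵢ - U₂ᵢ)² / (4 (1 - dᵢ)))`.

No determinant and no formula for the information of a Gaussian pair is needed, and the joint law
may be singular.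

**Attainment.** For the variance matrix `Qs d 1` the difference `Y₁ - Y₂` is independent of
`(A, W)` and so carries no information on `W` (`mutualInfo_le_of_indepFun`), while `exp f` is
exactly the density of the law of `(A, W)` (`map_add_prodMk_eq_tilted`); the bound is an equality.

**Uniqueness.** If the term `E (U₁ᵢ - U₂ᵢ)²` vanishes for all `i`, then `Y₁` and `Y₂` have the same
covariance with `W`. Under `Qs d Q` these covariances are `D^{1/2}` and `D^{1/2} Q`, so `Q = 1`
(`tripleInfo_gaussQs_one_lt`).

**Minimality of the dimension.** If `W` had fewer than `n` entries, some nonzero linear form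
`x · Y₁` would be uncorrelated with `W`, hence independent of it by Gaussianity. Its conditional
mean would vanish, and conditional independence would make `x · Y₁` uncorrelated with `Y₂`, against
`dᵢ ≠ 0` (`IsCIG.le_card`).

**Realizations.** The residuals `Y₁ - D^{1/2} Q⁻¹ W` and `Y₂ - D^{1/2} W` are uncorrelated with each
other and with `W`. This block diagonalizes `Qs d Q`, shows that it is positive semidefinite for
`Q` in `QWset d`, and gives conditional independence (`Qs_eq`, `isG0_noise`,
`condIndepFun_of_indepFun`); at `Q = 1` the residuals are `Z₁` and `Z₂`.
-/

/-! ### Linear images of centred Gaussian vectors -/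

namespace GaussianCI

variable {Ω : Type*} [MeasurableSpace Ω] {P : Measure Ω}
variable {ι κ : Type*} [Fintype ι] [Fintype κ] [DecidableEq ι] [DecidableEq κ]

/-- The image of a column vector under a rectangular matrix. -/
noncomputable def mulVecE (A : Matrix ι κ ℝ) : Vec κ →L[ℝ] Vec ι :=
  LinearMap.toContinuousLinearMap (Matrix.toEuclideanLin A)

omit [DecidableEq ι] in
theorem mulVecE_apply (A : Matrix ι κ ℝ) (x : Vec κ) :
    mulVecE A x = WithLp.toLp 2 (A *ᵥ x.ofLp) := rfl

theorem inner_mulVecE (A : Matrix ι κ ℝ) (x : Vec κ) (t : Vec ι) :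
    inner ℝ (mulVecE A x) t = inner ℝ x (mulVecE Aᵀ t) := by
  simp only [mulVecE_apply, EuclideanSpace.inner_eq_star_dotProduct, star_trivial]
  rw [Matrix.dotProduct_mulVec, Matrix.mulVec_transpose]

theorem map_mulVecE_multivariateGaussian (A : Matrix ι κ ℝ) {S : Matrix κ κ ℝ}
    (hS : S.PosSemidef) :
    (multivariateGaussian 0 S).map (mulVecE A) = multivariateGaussian 0 (A * S * Aᵀ) := by
  have hS' : (A * S * Aᵀ).PosSemidef := by
    simpa [Matrix.conjTranspose_eq_transpose_of_trivial] using hS.mul_mul_conjTranspose_same A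
  have : IsProbabilityMeasure ((multivariateGaussian 0 S).map (mulVecE A)) :=
    Measure.isProbabilityMeasure_map (by fun_prop)
  apply Measure.ext_of_charFun
  ext t
  rw [charFun_apply, integral_map (by fun_prop) (by fun_prop)]
  simp_rw [inner_mulVecE]
  rw [← charFun_apply, charFun_multivariateGaussian hS, charFun_multivariateGaussian hS']
  simp [mulVecE_apply, Matrix.dotProduct_mulVec, Matrix.vecMul_mulVec,
    Matrix.mul_assoc]

namespace IsG0

variable {X : Ω → Vec κ} {S : Matrix κ κ ℝ}

theorem aemeasurable (h : IsG0 X S P) : AEMeasurable X P := h.2.aemeasurable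

theorem hasGaussianLaw (h : IsG0 X S P) : HasGaussianLaw X P := h.2.hasGaussianLaw

theorem isProbabilityMeasure (h : IsG0 X S P) : IsProbabilityMeasure P :=
  h.hasGaussianLaw.isProbabilityMeasure

theorem mulVecE (h : IsG0 X S P) (A : Matrix ι κ ℝ) :
    IsG0 (fun ω => mulVecE A (X ω)) (A * S * Aᵀ) P := by
  refine ⟨by simpa [Matrix.conjTranspose_eq_transpose_of_trivial] using
    h.1.mul_mul_conjTranspose_same A, ?_⟩
  exact HasLaw.comp (Y := GaussianCI.mulVecE A)
    ⟨by fun_prop, map_mulVecE_multivariateGaussian A h.1⟩ h.2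

theorem of_multivariateGaussian (hS : S.PosSemidef) : IsG0 id S (multivariateGaussian 0 S) :=
  ⟨hS, ⟨by fun_prop, Measure.map_id⟩⟩

theorem memLp_eval (h : IsG0 X S P) (i : κ) : MemLp (fun ω => X ω i) 2 P := by
  have : HasGaussianLaw (fun ω => X ω i) P :=
    h.hasGaussianLaw.map_fun (EuclideanSpace.proj (𝕜 := ℝ) i)
  exact this.memLp_two

theorem integral_eval (h : IsG0 X S P) (i : κ) : ∫ ω, X ω i ∂P = 0 := by
  have := h.2.integral_comp (f := fun x : Vec κ => x i) (by fun_prop)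
  simp only [Function.comp_def] at this
  rw [this]
  have h2 := (measurePreserving_eval_multivariateGaussian (μ := 0) h.1 (i := i))
  have := h2.map_eq ▸ integral_map (μ := multivariateGaussian 0 S) (φ := fun x : Vec κ => x i)
    (f := fun x : ℝ => x) (by fun_prop) (by fun_prop)
  rw [← this]; simp

theorem covariance_eval (h : IsG0 X S P) (i j : κ) :
    cov[fun ω => X ω i, fun ω => X ω j; P] = S i j := by
  rw [← covariance_eval_multivariateGaussian (μ := 0) h.1, ← h.2.map_eq,
    covariance_map (by fun_prop) (by fun_prop) h.aemeasurable]
  rfl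

theorem integral_mul_eval (h : IsG0 X S P) (i j : κ) :
    ∫ ω, X ω i * X ω j ∂P = S i j := by
  have := h.isProbabilityMeasure
  rw [← h.covariance_eval, covariance_eq_sub (h.memLp_eval i) (h.memLp_eval j)]
  simp [h.integral_eval]

theorem covariance_inner (h : IsG0 X S P) (x y : Vec κ) :
    cov[fun ω => inner ℝ x (X ω), fun ω => inner ℝ y (X ω); P] = x.ofLp ⬝ᵥ S *ᵥ y.ofLp := by
  rw [← covarianceBilin_multivariateGaussian (μ := 0) h.1, covarianceBilin_apply_eq_cov
    IsGaussian.memLp_two_id, ← h.2.map_eq,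
    covariance_map (by fun_prop) (by fun_prop) h.aemeasurable]
  rfl

/-- The entries of a Gaussian vector with diagonal variance matrix are independent. -/
theorem iIndepFun_eval {v : κ → ℝ} (h : IsG0 X (Matrix.diagonal v) P) :
    iIndepFun (fun i ω => X ω i) P := by
  refine HasGaussianLaw.iIndepFun_of_covariance_eq_zero ?_ ?_
  · exact h.hasGaussianLaw.map_fun
      (EuclideanSpace.equiv κ ℝ).toContinuousLinearMap
  · intro i j hij
    rw [h.covariance_eval, Matrix.diagonal_apply_ne _ hij]

theorem map_eval (h : IsG0 X S P) (i : κ) :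
    P.map (fun ω => X ω i) = gaussianReal 0 (S i i).toNNReal := by
  have := (measurePreserving_eval_multivariateGaussian (μ := 0) h.1 (i := i)).map_eq
  rw [← h.2.map_eq, AEMeasurable.map_map_of_aemeasurable (by fun_prop) h.aemeasurable] at this
  simpa [Function.comp_def] using this

/-- The law of a Gaussian vector with diagonal variance matrix is a product measure. -/
theorem map_diagonal {v : κ → ℝ} (h : IsG0 X (Matrix.diagonal v) P) :
    P.map (fun ω => (X ω).ofLp) = Measure.pi fun i => gaussianReal 0 (v i).toNNReal := by
  have := h.isProbabilityMeasure
  have hm := h.aemeasurable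
  rw [(iIndepFun_iff_map_fun_eq_pi_map (by fun_prop)).1 h.iIndepFun_eval]
  simp [h.map_eval]

end IsG0

/-! ### Gaussian vectors in blocks -/

section Blocks

variable {X : Ω → Vec ι} {Y : Ω → Vec κ} {S : Matrix ι ι ℝ} {T : Matrix κ κ ℝ}

omit [DecidableEq ι] [DecidableEq κ] [Fintype ι] [Fintype κ] in
@[simp] theorem fstBlock_stack (x : Vec ι) (y : Vec κ) : fstBlock (stack x y) = x := rfl

omit [DecidableEq ι] [DecidableEq κ] [Fintype ι] [Fintype κ] in
@[simp] theorem sndBlock_stack (x : Vec ι) (y : Vec κ) : sndBlock (stack x y) = y := rfl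

omit [DecidableEq ι] [DecidableEq κ] [Fintype ι] [Fintype κ] in
@[simp] theorem stack_fstBlock_sndBlock (z : Vec (ι ⊕ κ)) :
    stack (fstBlock z) (sndBlock z) = z := by
  ext (i | i) <;> rfl

theorem fstBlock_eq_mulVecE (z : Vec (ι ⊕ κ)) :
    fstBlock z = mulVecE (Matrix.fromCols 1 0) z := by
  have : z = stack (fstBlock z) (sndBlock z) := by simp
  ext i
  rw [mulVecE_apply, this]
  simp [stack, fstBlock]

theorem sndBlock_eq_mulVecE (z : Vec (ι ⊕ κ)) :
    sndBlock z = mulVecE (Matrix.fromCols 0 1) z := by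
  have : z = stack (fstBlock z) (sndBlock z) := by simp
  ext i
  rw [mulVecE_apply, this]
  simp [stack, sndBlock]

theorem mulVecE_fromBlocks_stack {ι' κ' : Type*} [Fintype ι'] [Fintype κ'] (A : Matrix ι' ι ℝ)
    (B : Matrix ι' κ ℝ) (C : Matrix κ' ι ℝ) (D : Matrix κ' κ ℝ) (x : Vec ι) (y : Vec κ) :
    mulVecE (Matrix.fromBlocks A B C D) (stack x y) =
      stack (mulVecE A x + mulVecE B y) (mulVecE C x + mulVecE D y) := by
  ext (i | i) <;> simp [mulVecE_apply, stack, Matrix.fromBlocks_mulVec]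

theorem mulVecE_fromCols_stack {ι' : Type*} [Fintype ι'] (A : Matrix ι' ι ℝ)
    (B : Matrix ι' κ ℝ) (x : Vec ι) (y : Vec κ) :
    mulVecE (Matrix.fromCols A B) (stack x y) = mulVecE A x + mulVecE B y := by
  ext i; simp [mulVecE_apply, stack]

omit [DecidableEq ι] [DecidableEq κ] [Fintype ι] [Fintype κ] in
theorem measurable_stack : Measurable fun p : Vec ι × Vec κ => stack p.1 p.2 := by
  have : Measurable fun p : Vec ι × Vec κ => (Sum.elim p.1.ofLp p.2.ofLp : ι ⊕ κ → ℝ) := by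
    refine measurable_pi_iff.2 ?_
    rintro (i | i) <;> simp <;> fun_prop
  unfold stack
  fun_prop

theorem hasGaussianLaw_blocks (h : HasGaussianLaw (fun ω => stack (X ω) (Y ω)) P) :
    HasGaussianLaw (fun ω => (X ω, Y ω)) P := by
  have := h.map_fun ((mulVecE (Matrix.fromCols 1 0) : Vec (ι ⊕ κ) →L[ℝ] Vec ι).prod
      (mulVecE (Matrix.fromCols 0 1) : Vec (ι ⊕ κ) →L[ℝ] Vec κ))
  simpa [← fstBlock_eq_mulVecE, ← sndBlock_eq_mulVecE] using this

omit [DecidableEq ι] [DecidableEq κ] in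
theorem inner_stack (x x' : Vec ι) (y y' : Vec κ) :
    inner ℝ (stack x y) (stack x' y') = inner ℝ x x' + inner ℝ y y' := by
  simp [PiLp.inner_apply, stack]

theorem IsG0.fst {R : Matrix ι κ ℝ} {R' : Matrix κ ι ℝ}
    (h : IsG0 (fun ω => stack (X ω) (Y ω)) (Matrix.fromBlocks S R R' T) P) :
    IsG0 X S P := by
  have := h.mulVecE (Matrix.fromCols (1 : Matrix ι ι ℝ) (0 : Matrix ι κ ℝ))
  simp only [← fstBlock_eq_mulVecE, fstBlock_stack] at this
  convert this
  rw [Matrix.fromCols_mul_fromBlocks, Matrix.transpose_fromCols, Matrix.fromCols_mul_fromRows]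
  simp

theorem IsG0.snd {R : Matrix ι κ ℝ} {R' : Matrix κ ι ℝ}
    (h : IsG0 (fun ω => stack (X ω) (Y ω)) (Matrix.fromBlocks S R R' T) P) :
    IsG0 Y T P := by
  have := h.mulVecE (Matrix.fromCols (0 : Matrix κ ι ℝ) (1 : Matrix κ κ ℝ))
  simp only [← sndBlock_eq_mulVecE, sndBlock_stack] at this
  convert this
  rw [Matrix.fromCols_mul_fromBlocks, Matrix.transpose_fromCols, Matrix.fromCols_mul_fromRows]
  simp

/-- Uncorrelated blocks of a Gaussian vector are independent. -/
theorem IsG0.indepFun_blocks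
    (h : IsG0 (fun ω => stack (X ω) (Y ω)) (Matrix.fromBlocks S 0 0 T) P) : IndepFun X Y P := by
  refine HasGaussianLaw.indepFun_of_covariance_inner (hasGaussianLaw_blocks h.hasGaussianLaw) fun x y => ?_
  have := h.covariance_inner (stack x 0) (stack 0 y)
  simp only [inner_stack, inner_zero_left, add_zero, zero_add] at this
  rw [this]
  simp [stack, Matrix.fromBlocks_mulVec]

omit [DecidableEq ι] [DecidableEq κ] in
theorem posSemidef_fromBlocks_diag (hS : S.PosSemidef) (hT : T.PosSemidef) :
    (Matrix.fromBlocks S 0 0 T).PosSemidef := by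
  refine Matrix.PosSemidef.of_dotProduct_mulVec_nonneg ?_ fun x => ?_
  · have h1 : Sᴴ = S := hS.1
    have h2 : Tᴴ = T := hT.1
    rw [Matrix.IsHermitian, Matrix.fromBlocks_conjTranspose, h1, h2]
    simp
  · have h1 := hS.dotProduct_mulVec_nonneg (x ∘ Sum.inl)
    have h2 := hT.dotProduct_mulVec_nonneg (x ∘ Sum.inr)
    simp only [Matrix.fromBlocks_mulVec, dotProduct, Fintype.sum_sum_type] at *
    simpa using add_nonneg h1 h2

/-- Independent Gaussian vectors are jointly Gaussian with block diagonal variance matrix. -/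
theorem IsG0.stack_of_indepFun (hX : IsG0 X S P) (hY : IsG0 Y T P) (h : IndepFun X Y P) :
    IsG0 (fun ω => stack (X ω) (Y ω)) (Matrix.fromBlocks S 0 0 T) P := by
  have := hX.isProbabilityMeasure
  have hpsd := posSemidef_fromBlocks_diag hX.1 hY.1
  have hm : AEMeasurable (fun ω => stack (X ω) (Y ω)) P :=
    measurable_stack.comp_aemeasurable (hX.aemeasurable.prodMk hY.aemeasurable)
  refine ⟨hpsd, hm, ?_⟩
  have h0 := IsG0.of_multivariateGaussian hpsd
  have h1 : IsG0 (fun z : Vec (ι ⊕ κ) => stack (fstBlock z) (sndBlock z))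
      (Matrix.fromBlocks S 0 0 T) (multivariateGaussian 0 (Matrix.fromBlocks S 0 0 T)) := by
    simp only [stack_fstBlock_sndBlock]
    exact h0
  have h2 := (indepFun_iff_map_prod_eq_prod_map_map hX.aemeasurable hY.aemeasurable).1 h
  have h3 := (indepFun_iff_map_prod_eq_prod_map_map measurable_fstBlock.aemeasurable
    measurable_sndBlock.aemeasurable).1 h1.indepFun_blocks
  have h4 := h1.fst.2.map_eq
  have h5 := h1.snd.2.map_eq
  calc P.map (fun ω => stack (X ω) (Y ω))
      = (P.map (fun ω => (X ω, Y ω))).map (fun p => stack p.1 p.2) := by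
        rw [AEMeasurable.map_map_of_aemeasurable measurable_stack.aemeasurable
          (hX.aemeasurable.prodMk hY.aemeasurable)]
        rfl
    _ = _ := by
        rw [h2, hX.2.map_eq, hY.2.map_eq, ← h4, ← h5]
        conv_lhs => rw [← h3]
        rw [Measure.map_map measurable_stack (measurable_fstBlock.prodMk measurable_sndBlock)]
        simp [Function.comp_def]

/-- Three uncorrelated blocks of a Gaussian vector are independent. -/
theorem iIndepFun_three_of_isG0 {X Y Z : Ω → Vec ι} {S T R : Matrix ι ι ℝ}
    (h : IsG0 (fun ω => stack (stack (X ω) (Y ω)) (Z ω))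
      (Matrix.fromBlocks (Matrix.fromBlocks S 0 0 T) 0 0 R) P) : iIndepFun ![X, Y, Z] P := by
  refine HasGaussianLaw.iIndepFun_of_covariance_inner (E := fun _ => Vec ι) ?_ ?_
  · let L : Vec ((ι ⊕ ι) ⊕ ι) →L[ℝ] (Fin 3 → Vec ι) := ContinuousLinearMap.pi
      ![mulVecE (Matrix.fromCols (Matrix.fromCols 1 0) 0),
        mulVecE (Matrix.fromCols (Matrix.fromCols 0 1) 0), mulVecE (Matrix.fromCols 0 1)]
    refine (h.hasGaussianLaw.map_fun L).congr (ae_of_all _ fun ω => ?_)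
    funext i
    fin_cases i <;> simp [L, mulVecE_apply] <;> rfl
  · have key (a b c a' b' c' : Vec ι) :=
      h.covariance_inner (stack (stack a b) c) (stack (stack a' b') c')
    simp only [inner_stack] at key
    intro i j hij x y
    fin_cases i <;> fin_cases j <;> first | exact absurd rfl hij | skip
    · simpa [stack, Matrix.fromBlocks_mulVec] using key x 0 0 0 y 0
    · simpa [stack, Matrix.fromBlocks_mulVec] using key x 0 0 0 0 y
    · simpa [stack, Matrix.fromBlocks_mulVec] using key 0 x 0 y 0 0
    · simpa [stack, Matrix.fromBlocks_mulVec] using key 0 x 0 0 0 y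
    · simpa [stack, Matrix.fromBlocks_mulVec] using key 0 0 x y 0 0
    · simpa [stack, Matrix.fromBlocks_mulVec] using key 0 0 x 0 y 0

end Blocks

/-! ### Variational bounds for the Kullback-Leibler divergence -/

section KL

variable {α : Type*} [MeasurableSpace α] {μ ν : Measure α} [IsProbabilityMeasure μ]
  [IsProbabilityMeasure ν]

/-- The Donsker–Varadhan lower bound, for a normalized `exp f`: the defect is the divergence of `μ`
from the tilted measure. -/
theorem ofReal_integral_le_klDiv {f : α → ℝ} (hf : Integrable f μ)
    (he : Integrable (fun x => Real.exp (f x)) ν) (h1 : ∫ x, Real.exp (f x) ∂ν = 1) :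
    ENNReal.ofReal (∫ x, f x ∂μ) ≤ InformationTheory.klDiv μ ν := by
  by_cases h : InformationTheory.klDiv μ ν = ∞
  · simp [h]
  obtain ⟨hac, hint⟩ := InformationTheory.klDiv_ne_top_iff.1 h
  have : IsProbabilityMeasure (ν.tilted f) := isProbabilityMeasure_tilted he
  have h2 := integral_llr_tilted_right hac hf he hint
  have hac' : μ ≪ ν.tilted f := hac.trans (absolutelyContinuous_tilted he)
  have h3 := InformationTheory.toReal_klDiv_of_measure_eq hac' (by simp)
  have h4 := InformationTheory.toReal_klDiv_of_measure_eq hac (by simp)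
  rw [ENNReal.ofReal_le_iff_le_toReal h, h4]
  have : 0 ≤ (InformationTheory.klDiv μ (ν.tilted f)).toReal := ENNReal.toReal_nonneg
  rw [h3, h2, h1, Real.log_one] at this
  linarith

/-- Equality in the Donsker–Varadhan bound. -/
theorem klDiv_tilted {f : α → ℝ}
    (he : Integrable (fun x => Real.exp (f x)) ν) (h1 : ∫ x, Real.exp (f x) ∂ν = 1)
    (hμ : μ = ν.tilted f) (hf : Integrable f μ) :
    InformationTheory.klDiv μ ν = ENNReal.ofReal (∫ x, f x ∂μ) := by
  have hac : μ ≪ ν := hμ ▸ tilted_absolutelyContinuous ν f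
  have h2 : llr μ ν =ᵐ[μ] f := by
    have := log_rnDeriv_tilted_left_self he
    rw [← hμ, h1, Real.log_one] at this
    filter_upwards [hac.ae_le this] with x hx
    simpa [llr] using hx
  have hint : Integrable (llr μ ν) μ := hf.congr h2.symm
  rw [InformationTheory.klDiv_of_ac_of_integrable hac hint, integral_congr_ae h2]
  simp

/-- Appending the same independent component to both measures does not increase the divergence, nor
does applying a map afterwards. -/
theorem klDiv_map_prod_const_le {β γ : Type*} [MeasurableSpace β] [MeasurableSpace γ]
    (ρ : Measure β) [IsProbabilityMeasure ρ] {T : α × β → γ} (hT : Measurable T) :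
    InformationTheory.klDiv ((μ.prod ρ).map T) ((ν.prod ρ).map T) ≤
      InformationTheory.klDiv μ ν := by
  refine (InformationTheory.klDiv_map_le _ _ hT).trans ?_
  rw [← Measure.compProd_const, ← Measure.compProd_const, InformationTheory.klDiv_compProd_left]

end KL

/-! ### Density ratios of Gaussians and of their products -/

/-- The logarithm of the density of `N(m, s)` with respect to `N(0, v)`, for variances
`s` and `v`. -/
noncomputable def logRatio (m s v x : ℝ) : ℝ :=
  1 / 2 * Real.log (v / s) - (x - m) ^ 2 / (2 * s) + x ^ 2 / (2 * v)

theorem measurable_logRatio {α : Type*} [MeasurableSpace α] {m x : α → ℝ} (hm : Measurable m)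
    (hx : Measurable x) (s v : ℝ) : Measurable fun a => logRatio (m a) s v (x a) := by
  unfold logRatio
  fun_prop

theorem exp_logRatio_mul (m : ℝ) {s v : ℝ} (hs : 0 < s) (hv : 0 < v) (x : ℝ) :
    gaussianPDFReal 0 v.toNNReal x * Real.exp (logRatio m s v x) =
      gaussianPDFReal m s.toNNReal x := by
  have h1 : Real.exp (1 / 2 * Real.log (v / s)) = √v / √s := by
    rw [← Real.sqrt_div hv.le, Real.sqrt_eq_rpow, Real.rpow_def_of_pos (by positivity), mul_comm]
  simp only [gaussianPDFReal, Real.coe_toNNReal _ hs.le, Real.coe_toNNReal _ hv.le]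
  rw [logRatio, sub_add, sub_eq_add_neg (1 / 2 * _), Real.exp_add, h1]
  rw [Real.sqrt_mul (by positivity), Real.sqrt_mul (x := 2 * Real.pi) (by positivity) s]
  have h2 : Real.exp (-(x - 0) ^ 2 / (2 * v)) *
      Real.exp (-((x - m) ^ 2 / (2 * s) - x ^ 2 / (2 * v))) =
      Real.exp (-(x - m) ^ 2 / (2 * s)) := by
    rw [← Real.exp_add]; congr 1; ring
  have := Real.sqrt_pos.2 hs
  have := Real.sqrt_pos.2 hv
  rw [← h2]
  field_simp

theorem gaussianReal_withDensity_exp_logRatio (m : ℝ) {s v : ℝ} (hs : 0 < s) (hv : 0 < v) :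
    (gaussianReal 0 v.toNNReal).withDensity (fun x => ENNReal.ofReal (Real.exp (logRatio m s v x)))
      = gaussianReal m s.toNNReal := by
  rw [gaussianReal_of_var_ne_zero _ (by simpa using hv),
    gaussianReal_of_var_ne_zero _ (by simpa using hs),
    ← withDensity_mul _ (by fun_prop) (by unfold logRatio; fun_prop)]
  congr 1
  ext x
  rw [Pi.mul_apply, gaussianPDF, gaussianPDF, ← ENNReal.ofReal_mul (gaussianPDFReal_nonneg _ _ _),
    exp_logRatio_mul m hs hv]

/-- A product of measures with densities has the product density. -/
theorem pi_withDensity {ι : Type*} [Fintype ι] {α : ι → Type*} [∀ i, MeasurableSpace (α i)]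
    (μ : ∀ i, Measure (α i)) [∀ i, IsProbabilityMeasure (μ i)] {g : ∀ i, α i → ℝ≥0∞}
    (hg : ∀ i, Measurable (g i)) [∀ i, SigmaFinite ((μ i).withDensity (g i))] :
    (Measure.pi μ).withDensity (fun x => ∏ i, g i (x i)) =
      Measure.pi fun i => (μ i).withDensity (g i) := by
  refine (Measure.pi_eq fun s hs => ?_).symm
  rw [withDensity_apply _ (.univ_pi hs), ← lintegral_indicator (.univ_pi hs)]
  have hm (i) : Measurable ((s i).indicator (g i)) := (hg i).indicator (hs i)
  have : (Set.univ.pi s).indicator (fun x => ∏ i, g i (x i)) =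
      fun x => ∏ i, (s i).indicator (g i) (x i) := by
    ext x
    by_cases hx : x ∈ Set.univ.pi s
    · rw [Set.indicator_of_mem hx]
      exact Finset.prod_congr rfl fun i _ => by rw [Set.indicator_of_mem (hx i trivial)]
    · rw [Set.indicator_of_notMem hx]
      obtain ⟨i, hi⟩ : ∃ i, x i ∉ s i := by simpa using hx
      exact (Finset.prod_eq_zero (Finset.mem_univ i) (Set.indicator_of_notMem hi _)).symm
  rw [this]
  refine (lintegral_prod_eq_prod_lintegral_of_indepFun Finset.univ
    (fun i (x : ∀ i, α i) => (s i).indicator (g i) (x i)) (iIndepFun_pi fun i => (hm i).aemeasurable)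
    (fun i => (hm i).comp (measurable_pi_apply i))).trans ?_
  refine Finset.prod_congr rfl fun i _ => ?_
  rw [withDensity_apply _ (hs i), ← lintegral_indicator (hs i),
    ← (measurePreserving_eval μ i).lintegral_comp (hm i)]

section Tilt

variable {κ : Type*} [Fintype κ] {F : Type*} [MeasurableSpace F]

/-- The logarithm of the density, with respect to a product of centred Gaussians with variances
`v`, of the conditional law given `w` that is a product of Gaussians with means `m w` and
variances `s`. -/
noncomputable def logDensity (m : F → κ → ℝ) (s v : κ → ℝ) (p : (κ → ℝ) × F) : ℝ :=
  ∑ i, logRatio (m p.2 i) (s i) (v i) (p.1 i)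

variable {m : F → κ → ℝ} {s v : κ → ℝ} (hm : Measurable m) (hs : ∀ i, 0 < s i)
  (hv : ∀ i, 0 < v i) (ρ : Measure F) [IsProbabilityMeasure ρ]

include hm in
theorem measurable_logDensity : Measurable (logDensity m s v) := by
  unfold logDensity
  refine Finset.measurable_sum _ fun i _ => measurable_logRatio ?_ ?_ _ _
  · exact (measurable_pi_apply i).comp (hm.comp measurable_snd)
  · exact (measurable_pi_apply i).comp measurable_fst

include hm hs hv in
/-- Weighting by `exp (logDensity m s v)` replaces, for each `w`, the centred product law by the
product of Gaussians with means `m w` and variances `s`. -/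
theorem lintegral_exp_logDensity_mul {g : (κ → ℝ) × F → ℝ≥0∞} (hg : Measurable g) :
    ∫⁻ p, ENNReal.ofReal (Real.exp (logDensity m s v p)) * g p
        ∂(Measure.pi fun i => gaussianReal 0 (v i).toNNReal).prod ρ =
      ∫⁻ w, ∫⁻ a, g (a, w) ∂(Measure.pi fun i => gaussianReal (m w i) (s i).toNNReal) ∂ρ := by
  have hmeas := measurable_logDensity (s := s) (v := v) hm
  rw [lintegral_prod_symm _ (by fun_prop)]
  refine lintegral_congr fun w => ?_
  have h1 (i : κ) := gaussianReal_withDensity_exp_logRatio (m w i) (hs i) (hv i)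
  have : ∀ i, SigmaFinite ((gaussianReal 0 (v i).toNNReal).withDensity
      (fun x => ENNReal.ofReal (Real.exp (logRatio (m w i) (s i) (v i) x)))) :=
    fun i => by rw [h1]; infer_instance
  have hmi (i : κ) : Measurable fun x =>
      ENNReal.ofReal (Real.exp (logRatio (m w i) (s i) (v i) x)) := by
    unfold logRatio; fun_prop
  have hprod : Measurable fun x : κ → ℝ =>
      ∏ i, ENNReal.ofReal (Real.exp (logRatio (m w i) (s i) (v i) (x i))) :=
    Finset.measurable_prod _ fun i _ => (hmi i).comp (measurable_pi_apply i)
  simp_rw [← h1]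
  rw [← pi_withDensity _ hmi, lintegral_withDensity_eq_lintegral_mul _
    hprod (by fun_prop)]
  refine lintegral_congr fun a => ?_
  simp only [Pi.mul_apply, logDensity, Real.exp_sum]
  rw [ENNReal.ofReal_prod_of_nonneg fun i _ => (Real.exp_pos _).le]

include hm hs hv in
theorem lintegral_exp_logDensity :
    ∫⁻ p, ENNReal.ofReal (Real.exp (logDensity m s v p))
      ∂(Measure.pi fun i => gaussianReal 0 (v i).toNNReal).prod ρ = 1 := by
  have := lintegral_exp_logDensity_mul hm hs hv ρ (g := fun _ => 1) measurable_const
  simpa using this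

include hm hs hv in
theorem integrable_exp_logDensity : Integrable (fun p => Real.exp (logDensity m s v p))
    ((Measure.pi fun i => gaussianReal 0 (v i).toNNReal).prod ρ) := by
  have hmeas := measurable_logDensity (s := s) (v := v) hm
  refine ⟨by fun_prop, ?_⟩
  rw [hasFiniteIntegral_iff_ofReal (ae_of_all _ fun p => (Real.exp_pos _).le),
    lintegral_exp_logDensity hm hs hv ρ]
  simp

include hm hs hv in
theorem integral_exp_logDensity : ∫ p, Real.exp (logDensity m s v p)
    ∂(Measure.pi fun i => gaussianReal 0 (v i).toNNReal).prod ρ = 1 := by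
  have hmeas := measurable_logDensity (s := s) (v := v) hm
  rw [integral_eq_lintegral_of_nonneg_ae (ae_of_all _ fun p => (Real.exp_pos _).le) (by fun_prop),
    lintegral_exp_logDensity hm hs hv ρ]
  simp

variable {Ω : Type*} [MeasurableSpace Ω] {P : Measure Ω} [IsProbabilityMeasure P]

include hm hs hv in
/-- If `X` is independent of `W` with independent centred Gaussian entries of variances `s`,
then the law of `(m(W) + X, W)` has the density given by `logDensity`. -/
theorem map_add_prodMk_eq_tilted {X : Ω → κ → ℝ} {W : Ω → F} (hX : Measurable X)
    (hW : Measurable W) (hXlaw : P.map X = Measure.pi fun i => gaussianReal 0 (s i).toNNReal)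
    (hind : IndepFun X W P) :
    P.map (fun ω => (m (W ω) + X ω, W ω)) =
      ((Measure.pi fun i => gaussianReal 0 (v i).toNNReal).prod (P.map W)).tilted
        (logDensity m s v) := by
  have := Measure.isProbabilityMeasure_map (μ := P) hW.aemeasurable
  have hmeas := measurable_logDensity (s := s) (v := v) hm
  refine Measure.ext_of_lintegral _ fun g hg => ?_
  rw [lintegral_tilted, integral_exp_logDensity hm hs hv]
  simp only [div_one]
  rw [lintegral_exp_logDensity_mul hm hs hv _ hg, lintegral_map hg (by fun_prop)]
  have h2 := (indepFun_iff_map_prod_eq_prod_map_map hX.aemeasurable hW.aemeasurable).1 hind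
  have h3 : ∫⁻ ω, g (m (W ω) + X ω, W ω) ∂P =
      ∫⁻ p, g (m p.2 + p.1, p.2) ∂(P.map fun ω => (X ω, W ω)) := by
    rw [lintegral_map (by fun_prop) (by fun_prop)]
  rw [h3, h2, lintegral_prod_symm _ (by fun_prop), hXlaw]
  refine lintegral_congr fun w => ?_
  have h4 : (Measure.pi fun i => gaussianReal (m w i) (s i).toNNReal) =
      (Measure.pi fun i => gaussianReal 0 (s i).toNNReal).map (fun x => m w + x) := by
    have := Measure.pi_map_pi (μ := fun i => gaussianReal 0 (s i).toNNReal)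
      (f := fun i x => m w i + x) (fun i => by fun_prop)
    simp only [gaussianReal_map_const_add, zero_add] at this
    exact this.symm
  rw [h4, lintegral_map (by fun_prop) (by fun_prop)]

end Tilt

/-! ### Second moments under conditional independence -/

section CondIndep

variable {Ω : Type*} {m mΩ : MeasurableSpace Ω} [StandardBorelSpace Ω] {μ : Measure Ω}
  [IsProbabilityMeasure μ]

/-- Conditionally independent variables have the same mixed second moment as their conditional
means. -/
theorem CondIndepFun.integral_mul_eq {hm : m ≤ mΩ} {X Z : Ω → ℝ} (hX : Measurable X)
    (hZ : Measurable Z) (hX2 : MemLp X 2 μ) (hZ2 : MemLp Z 2 μ) (h : CondIndepFun m hm X Z μ) :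
    ∫ ω, X ω * Z ω ∂μ = ∫ ω, (μ[X | m]) ω * (μ[Z | m]) ω ∂μ := by
  have hXZ : Integrable (fun ω => X ω * Z ω) μ := hX2.integrable_mul hZ2
  have h1 := condExp_ae_eq_integral_condExpKernel hm (hX2.integrable one_le_two)
  have h2 := condExp_ae_eq_integral_condExpKernel hm (hZ2.integrable one_le_two)
  have h3 := condExp_ae_eq_integral_condExpKernel hm hXZ
  have h4 := ae_of_ae_trim hm ((condIndepFun_iff_map_prod_eq_prod_map_map hX hZ).1 h)
  rw [← integral_condExp hm]
  refine integral_congr_ae ?_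
  filter_upwards [h1, h2, h3, h4] with ω h1 h2 h3 h4
  rw [h1, h2, h3]
  refine IndepFun.integral_fun_mul_eq_mul_integral ?_ hX.aestronglyMeasurable
    hZ.aestronglyMeasurable
  rw [indepFun_iff_map_prod_eq_prod_map_map hX.aemeasurable hZ.aemeasurable]
  rwa [Kernel.map_apply _ (by fun_prop), Kernel.prod_apply, Kernel.map_apply _ hX,
    Kernel.map_apply _ hZ] at h4

omit [StandardBorelSpace Ω] in
theorem integral_mul_condExp (hm : m ≤ mΩ) {T S : Ω → ℝ} (hT : MemLp T 2 μ)
    (hS : StronglyMeasurable[m] S) (hS2 : MemLp S 2 μ) :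
    ∫ ω, S ω * (μ[T | m]) ω ∂μ = ∫ ω, S ω * T ω ∂μ := by
  rw [← integral_condExp hm (f := fun ω => S ω * T ω)]
  exact integral_congr_ae (condExp_mul_of_stronglyMeasurable_left hS (hS2.integrable_mul hT)
    (hT.integrable one_le_two)).symm

omit [StandardBorelSpace Ω] in
/-- Pythagoras for the conditional expectation. -/
theorem integral_sub_condExp_sq (hm : m ≤ mΩ) {T : Ω → ℝ} (hT : MemLp T 2 μ) :
    ∫ ω, (T ω - (μ[T | m]) ω) ^ 2 ∂μ = ∫ ω, T ω ^ 2 ∂μ - ∫ ω, (μ[T | m]) ω ^ 2 ∂μ := by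
  have hc : MemLp (μ[T | m]) 2 μ := hT.condExp one_le_two
  have h1 := integral_mul_condExp hm hT stronglyMeasurable_condExp hc
  have e : ∀ ω, (T ω - (μ[T | m]) ω) ^ 2 =
    T ω ^ 2 - 2 * ((μ[T | m]) ω * T ω) + (μ[T | m]) ω ^ 2 := fun ω => by ring
  have i2 : Integrable (fun ω => (μ[T | m]) ω * T ω) μ := hc.integrable_mul hT
  have i3 : Integrable (fun ω => T ω ^ 2 - 2 * ((μ[T | m]) ω * T ω)) μ :=
    hT.integrable_sq.sub (i2.const_mul 2)
  simp_rw [e]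
  rw [integral_add i3 hc.integrable_sq,
    integral_sub hT.integrable_sq (i2.const_mul 2), integral_const_mul, ← h1]
  simp_rw [← pow_two]
  ring

/-- The residual variance of the sum of two conditionally independent variables, in terms of the
mean square distance of their conditional means. It follows from
`(U + V)² = (U - V)² + 4 U V` and `CondIndepFun.integral_mul_eq`. -/
theorem integral_add_sub_condExp_sq {hm : m ≤ mΩ} {X Z : Ω → ℝ} (hX : Measurable X)
    (hZ : Measurable Z) (hX2 : MemLp X 2 μ) (hZ2 : MemLp Z 2 μ) (h : CondIndepFun m hm X Z μ) :
    ∫ ω, (X ω + Z ω - (μ[X + Z | m]) ω) ^ 2 ∂μ = ∫ ω, X ω ^ 2 ∂μ + ∫ ω, Z ω ^ 2 ∂μ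
      - 2 * ∫ ω, X ω * Z ω ∂μ - ∫ ω, ((μ[X | m]) ω - (μ[Z | m]) ω) ^ 2 ∂μ := by
  have hU : MemLp (μ[X | m]) 2 μ := hX2.condExp one_le_two
  have hV : MemLp (μ[Z | m]) 2 μ := hZ2.condExp one_le_two
  have hXZ : Integrable (fun ω => X ω * Z ω) μ := hX2.integrable_mul hZ2
  have hUV : Integrable (fun ω => (μ[X | m]) ω * (μ[Z | m]) ω) μ := hU.integrable_mul hV
  have key := CondIndepFun.integral_mul_eq hX hZ hX2 hZ2 h
  have h1 := integral_sub_condExp_sq hm (hX2.add hZ2)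
  simp only [Pi.add_apply] at h1
  have h2 : ∫ ω, (X ω + Z ω) ^ 2 ∂μ =
      ∫ ω, X ω ^ 2 ∂μ + 2 * ∫ ω, X ω * Z ω ∂μ + ∫ ω, Z ω ^ 2 ∂μ := by
    have i3 : Integrable (fun ω => X ω ^ 2 + 2 * (X ω * Z ω)) μ :=
      hX2.integrable_sq.add (hXZ.const_mul 2)
    simp_rw [add_sq, mul_assoc]
    rw [integral_add i3 hZ2.integrable_sq,
      integral_add hX2.integrable_sq (hXZ.const_mul 2), integral_const_mul]
  have h3 : ∫ ω, (μ[X + Z | m]) ω ^ 2 ∂μ =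
      ∫ ω, ((μ[X | m]) ω - (μ[Z | m]) ω) ^ 2 ∂μ + 4 * ∫ ω, (μ[X | m]) ω * (μ[Z | m]) ω ∂μ := by
    have i3 : Integrable (fun ω => ((μ[X | m]) ω - (μ[Z | m]) ω) ^ 2) μ :=
      (hU.sub hV).integrable_sq
    rw [← integral_const_mul, ← integral_add i3 (hUV.const_mul 4)]
    refine integral_congr_ae ?_
    filter_upwards [condExp_add (hX2.integrable one_le_two) (hZ2.integrable one_le_two) m] with ω h
    rw [h, Pi.add_apply]
    ring
  rw [h1, h2, h3, key]
  ring

end CondIndep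

/-! ### Conditional independence from independent noises -/

section Build

variable {Ω β β' γ E₁ E₂ : Type*} [MeasurableSpace Ω] [StandardBorelSpace Ω] {P : Measure Ω}
  [IsProbabilityMeasure P] [MeasurableSpace β] [MeasurableSpace β'] [MeasurableSpace γ]
  [MeasurableSpace E₁] [MeasurableSpace E₂]
  [StandardBorelSpace β] [StandardBorelSpace β'] [Nonempty β] [Nonempty β']

omit [StandardBorelSpace Ω] [StandardBorelSpace β] [Nonempty β] in
/-- If `N` is independent of `V`, the conditional law of `f(V, N)` given `V = v` is the law of
`f(v, N)`. -/
theorem map_prodMk_eq_compProd {V : Ω → γ} {N : Ω → E₁} (hV : Measurable V) (hN : Measurable N)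
    (h : IndepFun V N P) {f : γ × E₁ → β} (hf : Measurable f) :
    P.map (fun ω => (V ω, f (V ω, N ω))) =
      P.map V ⊗ₘ ((Kernel.id ×ₖ Kernel.const γ (P.map N)).map f) := by
  have := Measure.isProbabilityMeasure_map (μ := P) hV.aemeasurable
  have := Measure.isProbabilityMeasure_map (μ := P) hN.aemeasurable
  have h2 := (indepFun_iff_map_prod_eq_prod_map_map hV.aemeasurable hN.aemeasurable).1 h
  have : P.map (fun ω => (V ω, f (V ω, N ω))) =
      ((P.map V).prod (P.map N)).map (fun p => (p.1, f p)) := by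
    rw [← h2, Measure.map_map (by fun_prop) (by fun_prop)]
    rfl
  rw [this]
  refine Measure.ext_of_lintegral _ fun g hg => ?_
  rw [lintegral_map hg (by fun_prop), lintegral_prod _ (by fun_prop),
    Measure.lintegral_compProd hg]
  refine lintegral_congr fun v => ?_
  rw [Kernel.map_apply _ hf, lintegral_map (by fun_prop) hf, Kernel.prod_apply, Kernel.id_apply,
    Kernel.const_apply, lintegral_prod _ (by fun_prop), lintegral_dirac' _ ]
  exact Measurable.lintegral_prod_right' (f := fun p : γ × E₁ => g (v, f p)) (by fun_prop)

/-- If `N₁`, `N₂`, `W` are independent, functions of `(W, N₁)` and `(W, N₂)` are conditionally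
independent given `W`. -/
theorem condIndepFun_of_indepFun {W : Ω → γ} {N₁ : Ω → E₁} {N₂ : Ω → E₂} (hW : Measurable W)
    (hN₁ : Measurable N₁) (hN₂ : Measurable N₂) (h : IndepFun (fun ω => (W ω, N₂ ω)) N₁ P)
    {f : γ × E₁ → β} {g : γ × E₂ → β'} (hf : Measurable f) (hg : Measurable g) :
    CondIndepFun (MeasurableSpace.comap W inferInstance) hW.comap_le
      (fun ω => f (W ω, N₁ ω)) (fun ω => g (W ω, N₂ ω)) P := by
  have := Measure.isProbabilityMeasure_map (μ := P) hN₁.aemeasurable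
  refine CondIndepFun.symm ?_
  rw [condIndepFun_iff_condDistrib_prod_ae_eq_prodMkRight (by fun_prop) (by fun_prop) hW]
  set κ : Kernel γ β := (Kernel.id ×ₖ Kernel.const γ (P.map N₁)).map f with hκ
  have : IsMarkovKernel κ := Kernel.IsMarkovKernel.map _ hf
  have h1 : condDistrib (fun ω => f (W ω, N₁ ω)) W P =ᵐ[P.map W] κ :=
    condDistrib_ae_eq_of_measure_eq_compProd _ (by fun_prop)
      (map_prodMk_eq_compProd hW hN₁ (h.comp measurable_fst measurable_id) hf)
  have h2 : condDistrib (fun ω => f (W ω, N₁ ω)) (fun ω => (W ω, g (W ω, N₂ ω))) P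
      =ᵐ[P.map fun ω => (W ω, g (W ω, N₂ ω))] κ.prodMkRight β' := by
    refine condDistrib_ae_eq_of_measure_eq_compProd _ (by fun_prop) ?_
    have h3 : IndepFun (fun ω => (W ω, g (W ω, N₂ ω))) N₁ P :=
      h.comp (φ := fun p => (p.1, g p)) (by fun_prop) measurable_id
    have := map_prodMk_eq_compProd (by fun_prop) hN₁ h3
      (f := fun p : (γ × β') × E₁ => f (p.1.1, p.2)) (by fun_prop)
    rw [this]
    congr 1
    ext p s hs
    rw [Kernel.map_apply' _ (by fun_prop) _ hs, Kernel.prodMkRight_apply, hκ,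
      Kernel.map_apply' _ hf _ hs, Kernel.prod_apply, Kernel.prod_apply, Kernel.id_apply,
      Kernel.id_apply, Measure.dirac_prod, Measure.dirac_prod,
      Measure.map_apply (by fun_prop) (hs.preimage (by fun_prop)),
      Measure.map_apply (by fun_prop) (hs.preimage hf)]
    rfl
  have h4 : (condDistrib (fun ω => f (W ω, N₁ ω)) W P).prodMkRight β'
      =ᵐ[P.map fun ω => (W ω, g (W ω, N₂ ω))] κ.prodMkRight β' := by
    have : P.map W = (P.map fun ω => (W ω, g (W ω, N₂ ω))).map Prod.fst := by
      rw [Measure.map_map (by fun_prop) (by fun_prop)]; rfl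
    rw [this] at h1
    filter_upwards [ae_of_ae_map measurable_fst.aemeasurable h1] with p hp
    simpa [Kernel.prodMkRight_apply] using hp
  exact h2.trans h4.symm

end Build

/-! ### Data processing and the lower bound for mutual information -/

section MutualInfo

variable {Ω α β γ : Type*} [MeasurableSpace Ω] {P : Measure Ω} [IsProbabilityMeasure P]
  [MeasurableSpace α] [MeasurableSpace β] [MeasurableSpace γ]

/-- Data processing for mutual information. -/
theorem mutualInfo_comp_left_le {Y : Ω → α} {W : Ω → β} (hY : AEMeasurable Y P)
    (hW : AEMeasurable W P) {T : α → γ} (hT : Measurable T) :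
    mutualInfo (fun ω => T (Y ω)) W P ≤ mutualInfo Y W P := by
  have := Measure.isProbabilityMeasure_map hY
  have := Measure.isProbabilityMeasure_map hW
  have h := InformationTheory.klDiv_map_le (P.map (fun ω => (Y ω, W ω)))
    ((P.map Y).prod (P.map W)) (hT.prodMap measurable_id (γ := β))
  rw [← Measure.map_prod_map _ _ hT measurable_id, Measure.map_id,
    AEMeasurable.map_map_of_aemeasurable (by fun_prop) (by fun_prop),
    AEMeasurable.map_map_of_aemeasurable (by fun_prop) (by fun_prop)] at h
  exact h

end MutualInfo

section LowerBound

variable {κ : Type*} [Fintype κ] {F : Type*} {Ω : Type*}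

theorem integrable_logRatio [MeasurableSpace Ω] {P : Measure Ω} [IsProbabilityMeasure P]
    {a u : Ω → ℝ} (ha : MemLp a 2 P) (hu : MemLp u 2 P) (s v : ℝ) :
    Integrable (fun ω => logRatio (u ω) s v (a ω)) P := by
  unfold logRatio
  exact ((integrable_const _).sub ((ha.sub hu).integrable_sq.div_const _)).add
    (ha.integrable_sq.div_const _)

theorem integral_logRatio [MeasurableSpace Ω] {P : Measure Ω} [IsProbabilityMeasure P]
    {a u : Ω → ℝ} (ha : MemLp a 2 P) (hu : MemLp u 2 P) (s v : ℝ) :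
    ∫ ω, logRatio (u ω) s v (a ω) ∂P = 1 / 2 * Real.log (v / s)
      - (∫ ω, (a ω - u ω) ^ 2 ∂P) / (2 * s) + (∫ ω, a ω ^ 2 ∂P) / (2 * v) := by
  unfold logRatio
  have h1 : Integrable (fun ω => (a ω - u ω) ^ 2 / (2 * s)) P :=
    (ha.sub hu).integrable_sq.div_const _
  have h2 : Integrable (fun ω => 1 / 2 * Real.log (v / s) - (a ω - u ω) ^ 2 / (2 * s)) P :=
    (integrable_const _).sub h1
  rw [integral_add h2 (ha.integrable_sq.div_const _),
    integral_sub (integrable_const _) h1, integral_div, integral_div]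
  simp

section

variable [MeasurableSpace Ω] {P : Measure Ω} [IsProbabilityMeasure P] {A : Ω → κ → ℝ} {W : Ω → F}
  {m : F → κ → ℝ} (hA : ∀ i, MemLp (fun ω => A ω i) 2 P)
  (hm : ∀ i, MemLp (fun ω => m (W ω) i) 2 P) (s v : κ → ℝ)

include hA hm

theorem integrable_logDensity : Integrable (fun ω => logDensity m s v (A ω, W ω)) P :=
  integrable_finsetSum _ fun i _ => integrable_logRatio (hA i) (hm i) _ _

theorem integral_logDensity : ∫ ω, logDensity m s v (A ω, W ω) ∂P =
    ∑ i, (1 / 2 * Real.log (v i / s i) - (∫ ω, (A ω i - m (W ω) i) ^ 2 ∂P) / (2 * s i)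
      + (∫ ω, A ω i ^ 2 ∂P) / (2 * v i)) := by
  unfold logDensity
  rw [integral_finsetSum _ fun i _ => integrable_logRatio (hA i) (hm i) _ _]
  exact Finset.sum_congr rfl fun i _ => integral_logRatio (hA i) (hm i) _ _

end

theorem memLp_of_map_eq_pi [MeasurableSpace Ω] {P : Measure Ω}
    {A : Ω → κ → ℝ} (hA : Measurable A) {v : κ → ℝ}
    (h : P.map A = Measure.pi fun i => gaussianReal 0 (v i).toNNReal) (hv : ∀ i, 0 < v i) (i : κ) :
    MemLp (fun ω => A ω i) 2 P ∧ ∫ ω, A ω i ^ 2 ∂P = v i := by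
  have h1 : P.map (fun ω => A ω i) = gaussianReal 0 (v i).toNNReal := by
    rw [← (measurePreserving_eval (fun i => gaussianReal 0 (v i).toNNReal) i).map_eq, ← h,
      Measure.map_map (by fun_prop) hA]
    rfl
  have hAi : Measurable fun ω => A ω i := by fun_prop
  have h2 : MemLp id 2 (gaussianReal 0 (v i).toNNReal) := memLp_id_gaussianReal 2
  constructor
  · rw [← h1] at h2
    exact (memLp_map_measure_iff (by fun_prop) hAi.aemeasurable).1 h2
  · have h3 := variance_id_gaussianReal (μ := 0) (v := (v i).toNNReal)
    rw [variance_eq_sub h2] at h3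
    simp only [id, integral_id_gaussianReal, Pi.pow_apply] at h3
    rw [← h1, integral_map (by fun_prop) (by fun_prop)] at h3
    simpa [(hv i).le] using h3

/-- Conditional independence of `X i` and `Z i` given `W` bounds from below the information on
`W` carried by the sums `X i + Z i`, when these are independent Gaussians of variances
`2 (1 + d i)`. The bound is the expectation of the log-density ratio at the conditional
means of the sums. -/
theorem sum_log_le_mutualInfo [MeasurableSpace F] [MeasurableSpace Ω] [StandardBorelSpace Ω] {P : Measure Ω}
    [IsProbabilityMeasure P] {W : Ω → F} (hW : Measurable W) {X Z : κ → Ω → ℝ}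
    (hX : ∀ i, Measurable (X i)) (hZ : ∀ i, Measurable (Z i)) (hX2 : ∀ i, MemLp (X i) 2 P)
    (hZ2 : ∀ i, MemLp (Z i) 2 P) {d : κ → ℝ} (hd : ∀ i, 0 < d i ∧ d i < 1)
    (hXX : ∀ i, ∫ ω, X i ω ^ 2 ∂P = 1) (hZZ : ∀ i, ∫ ω, Z i ω ^ 2 ∂P = 1)
    (hXZ : ∀ i, ∫ ω, X i ω * Z i ω ∂P = d i)
    (hA : P.map (fun ω i => X i ω + Z i ω) =
      Measure.pi fun i => gaussianReal 0 (2 * (1 + d i)).toNNReal)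
    (hci : ∀ i, CondIndepFun (MeasurableSpace.comap W inferInstance) hW.comap_le (X i) (Z i) P) :
    ENNReal.ofReal (∑ i, (1 / 2 * Real.log ((1 + d i) / (1 - d i)) +
      (∫ ω, ((P[X i | MeasurableSpace.comap W inferInstance]) ω -
        (P[Z i | MeasurableSpace.comap W inferInstance]) ω) ^ 2 ∂P) / (4 * (1 - d i)))) ≤
      mutualInfo (fun ω i => X i ω + Z i ω) W P := by
  have hs : ∀ i, 0 < 2 * (1 - d i) := fun i => by linarith [hd i]
  have hv : ∀ i, 0 < 2 * (1 + d i) := fun i => by linarith [hd i]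
  have hex (i : κ) : ∃ h : F → ℝ, StronglyMeasurable h ∧
      P[X i + Z i | MeasurableSpace.comap W inferInstance] = h ∘ W :=
    StronglyMeasurable.exists_eq_measurable_comp stronglyMeasurable_condExp
  -- `u i` represents the conditional mean of `X i + Z i` as a function of `W`.
  choose u hu hu' using hex
  have hAm : Measurable fun ω i => X i ω + Z i ω := measurable_pi_iff.2 fun i => (hX i).add (hZ i)
  have hum : Measurable fun w i => u i w := measurable_pi_iff.2 fun i => (hu i).measurable
  have := Measure.isProbabilityMeasure_map (μ := P) hW.aemeasurable
  have := Measure.isProbabilityMeasure_map (μ := P) (hAm.prodMk hW).aemeasurable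
  have hu2 (i : κ) : MemLp (fun ω => u i (W ω)) 2 P := by
    have : MemLp (P[X i + Z i | MeasurableSpace.comap W inferInstance]) 2 P :=
      ((hX2 i).add (hZ2 i)).condExp one_le_two
    rwa [hu'] at this
  have hld := measurable_logDensity (s := fun i => 2 * (1 - d i)) (v := fun i => 2 * (1 + d i)) hum
  have hA2 (i : κ) : MemLp (fun ω => X i ω + Z i ω) 2 P := (hX2 i).add (hZ2 i)
  have hint := integrable_logDensity (m := fun w i => u i w) hA2 hu2 (fun i => 2 * (1 - d i))
    (fun i => 2 * (1 + d i))
  unfold mutualInfo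
  rw [hA]
  refine le_trans (le_of_eq ?_) (ofReal_integral_le_klDiv
    (f := logDensity (fun w i => u i w) (fun i => 2 * (1 - d i)) (fun i => 2 * (1 + d i))) ?_
    (integrable_exp_logDensity hum hs hv _) (integral_exp_logDensity hum hs hv _))
  · rw [integral_map (by fun_prop) (by fun_prop)]
    rw [integral_logDensity (m := fun w i => u i w) hA2 hu2]
    congr 1
    refine Finset.sum_congr rfl fun i _ => ?_
    have h2 := integral_add_sub_condExp_sq (hX i) (hZ i) (hX2 i) (hZ2 i) (hci i)
    rw [hu'] at h2
    simp only [Function.comp_apply] at h2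
    have h3 := (memLp_of_map_eq_pi hAm hA hv i).2
    rw [h2, h3, hXX, hZZ, hXZ, mul_div_mul_left _ _ two_ne_zero]
    have := (hs i).ne'
    have := (hv i).ne'
    have : 1 - d i ≠ 0 := by linarith [hd i]
    have : 1 + d i ≠ 0 := by linarith [hd i]
    field_simp
    ring
  · exact (integrable_map_measure (by fun_prop) (by fun_prop)).2 hint

end LowerBound

/-! ### Block diagonalization of the variance matrices -/

section Matrices

variable {n : ℕ} {d : Fin n → ℝ} {Q : Matrix (Fin n) (Fin n) ℝ}

theorem transpose_diagSqrt (d : Fin n → ℝ) : (diagSqrt d)ᵀ = diagSqrt d := by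
  simp [diagSqrt]

theorem diagSqrt_mul_diagSqrt (hd : ∀ i, 0 ≤ d i) :
    diagSqrt d * diagSqrt d = Matrix.diagonal d := by
  simp [diagSqrt, Matrix.diagonal_mul_diagonal, Real.mul_self_sqrt (hd _)]

theorem QWset.transpose_eq (hQ : Q ∈ QWset d) : Qᵀ = Q := hQ.1

theorem QWset.posDef (hQ : Q ∈ QWset d) : Q.PosDef := by
  have := hQ.2.1.add_posSemidef hQ.2.2.1
  simpa using this

theorem QWset.isUnit_det (hQ : Q ∈ QWset d) : IsUnit Q.det :=
  (Matrix.isUnit_iff_isUnit_det _).1 (QWset.posDef hQ).isUnit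

theorem QWset.transpose_inv_eq (hQ : Q ∈ QWset d) : Q⁻¹ᵀ = Q⁻¹ := by
  rw [Matrix.transpose_nonsing_inv, QWset.transpose_eq hQ]

/-- The variance matrix of `Y₁ - D^{1/2} Q⁻¹ W`. The condition `D ≤ Q` is its positivity, by
taking Schur complements of `[[I, D^{1/2}], [D^{1/2}, Q]]` in both ways. -/
theorem posSemidef_one_sub_inv (hd : ∀ i, 0 ≤ d i) (hQ : Q ∈ QWset d) :
    (1 - diagSqrt d * Q⁻¹ * diagSqrt d).PosSemidef := by
  have h1 : (diagSqrt d)ᴴ = diagSqrt d := by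
    rw [Matrix.conjTranspose_eq_transpose_of_trivial, transpose_diagSqrt]
  have hpd := QWset.posDef hQ
  have := hpd.isUnit.invertible
  have : Invertible (1 : Matrix (Fin n) (Fin n) ℝ) := invertibleOne
  have h2 := (Matrix.PosDef.fromBlocks₁₁ (diagSqrt d) Q
    (Matrix.PosDef.one (n := Fin n) (R := ℝ))).2
    (by
      rw [h1, inv_one, Matrix.mul_one, diagSqrt_mul_diagSqrt hd]
      exact hQ.2.2.1)
  have h3 := (Matrix.PosDef.fromBlocks₂₂ 1 (diagSqrt d) hpd).1 h2
  rwa [h1] at h3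

/-- The variance matrix of `Y₂ - D^{1/2} W`, positive by the condition `Q ≤ D⁻¹`. -/
theorem posSemidef_one_sub (hd : ∀ i, 0 < d i) (hQ : Q ∈ QWset d) :
    (1 - diagSqrt d * Q * diagSqrt d).PosSemidef := by
  have h1 : (diagSqrt d)ᴴ = diagSqrt d := by
    rw [Matrix.conjTranspose_eq_transpose_of_trivial, transpose_diagSqrt]
  have h2 := hQ.2.2.2.mul_mul_conjTranspose_same (diagSqrt d)
  rw [h1, mul_sub, sub_mul] at h2
  convert h2 using 2
  have : (Matrix.diagonal d)⁻¹ = Matrix.diagonal (fun i => (d i)⁻¹) := by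
    refine Matrix.inv_eq_right_inv ?_
    simp [Matrix.diagonal_mul_diagonal, (hd _).ne']
  rw [this, diagSqrt, Matrix.diagonal_mul_diagonal, Matrix.diagonal_mul_diagonal, eq_comm,
    ← Matrix.diagonal_one]
  congr 1
  ext i
  have := Real.mul_self_sqrt (hd i).le
  have := (hd i).ne'
  field_simp
  nlinarith

/-- The variance matrix of `(Y₁ - D^{1/2} Q⁻¹ W, Y₂ - D^{1/2} W, W)` when `(Y₁, Y₂, W)` has
variance matrix `Qs d Q`. -/
noncomputable def noiseVar (d : Fin n → ℝ) (Q : Matrix (Fin n) (Fin n) ℝ) :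
    Matrix ((Fin n ⊕ Fin n) ⊕ Fin n) ((Fin n ⊕ Fin n) ⊕ Fin n) ℝ :=
  Matrix.fromBlocks (Matrix.fromBlocks (1 - diagSqrt d * Q⁻¹ * diagSqrt d) 0 0
    (1 - diagSqrt d * Q * diagSqrt d)) 0 0 Q

/-- The coefficients of the regression of `(Y₁, Y₂)` on `W`. -/
noncomputable def regr (d : Fin n → ℝ) (Q : Matrix (Fin n) (Fin n) ℝ) :
    Matrix (Fin n ⊕ Fin n) (Fin n) ℝ :=
  Matrix.fromRows (diagSqrt d * Q⁻¹) (diagSqrt d)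

/-- The block matrix `[[I, K], [0, I]]`, adding `K w` to the first block of `(y, w)`. -/
def shear (K : Matrix (Fin n ⊕ Fin n) (Fin n) ℝ) :
    Matrix ((Fin n ⊕ Fin n) ⊕ Fin n) ((Fin n ⊕ Fin n) ⊕ Fin n) ℝ :=
  Matrix.fromBlocks 1 K 0 1

/-- Block diagonalization of `Qs d Q` by the regression on `W`. -/
theorem Qs_eq (hd : ∀ i, 0 ≤ d i) (hQ : Q ∈ QWset d) :
    Qs d Q = shear (regr d Q) * noiseVar d Q *
      (shear (regr d Q))ᵀ := by
  have hu := QWset.isUnit_det hQ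
  have h1 : regr d Q * Q = Matrix.fromRows (diagSqrt d) (diagSqrt d * Q) := by
    rw [regr, Matrix.fromRows_mul, Matrix.mul_assoc, Matrix.nonsing_inv_mul _ hu, mul_one]
  have h2 : (regr d Q)ᵀ = Matrix.fromCols (Q⁻¹ * diagSqrt d) (diagSqrt d) := by
    rw [regr, Matrix.transpose_fromRows, Matrix.transpose_mul, transpose_diagSqrt,
      QWset.transpose_inv_eq hQ]
  have h3 : Q * (regr d Q)ᵀ = Matrix.fromCols (diagSqrt d) (Q * diagSqrt d) := by
    rw [h2, Matrix.mul_fromCols, Matrix.mul_nonsing_inv_cancel_left _ _ hu]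
  have h4 : regr d Q * Q * (regr d Q)ᵀ = Matrix.fromBlocks (diagSqrt d * Q⁻¹ * diagSqrt d)
      (Matrix.diagonal d) (Matrix.diagonal d) (diagSqrt d * Q * diagSqrt d) := by
    rw [h1, h2, Matrix.fromRows_mul_fromCols, diagSqrt_mul_diagSqrt hd, ← Matrix.mul_assoc,
      ← Matrix.mul_assoc, Matrix.mul_assoc _ Q, Matrix.mul_nonsing_inv _ hu, mul_one,
      diagSqrt_mul_diagSqrt hd]
  rw [shear, noiseVar, Matrix.fromBlocks_transpose, Matrix.fromBlocks_multiply,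
    Matrix.fromBlocks_multiply]
  simp only [Matrix.one_mul, Matrix.mul_zero, Matrix.zero_mul, add_zero, zero_add,
    Matrix.transpose_one, Matrix.transpose_zero, Matrix.mul_one]
  rw [h4, h1, h3, Qs, Qcorr, Matrix.fromBlocks_add]
  simp

theorem noiseVar_eq (hd : ∀ i, 0 ≤ d i) (hQ : Q ∈ QWset d) :
    shear (-regr d Q) * Qs d Q * (shear (-regr d Q))ᵀ =
      noiseVar d Q := by
  have h : shear (-regr d Q) * shear (regr d Q) = 1 := by
    rw [shear, shear, Matrix.fromBlocks_multiply, ← Matrix.fromBlocks_one]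
    simp
  have h' : (shear (regr d Q))ᵀ * (shear (-regr d Q))ᵀ = 1 := by
    rw [← Matrix.transpose_mul, h, Matrix.transpose_one]
  rw [Qs_eq hd hQ, Matrix.mul_assoc, Matrix.mul_assoc, Matrix.mul_assoc, h', Matrix.mul_one,
    ← Matrix.mul_assoc, h, Matrix.one_mul]

theorem posSemidef_Qs (hd : ∀ i, 0 < d i) (hQ : Q ∈ QWset d) : (Qs d Q).PosSemidef := by
  rw [Qs_eq (fun i => (hd i).le) hQ, ← Matrix.conjTranspose_eq_transpose_of_trivial]
  refine Matrix.PosSemidef.mul_mul_conjTranspose_same ?_ _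
  exact posSemidef_fromBlocks_diag (posSemidef_fromBlocks_diag
    (posSemidef_one_sub_inv (fun i => (hd i).le) hQ) (posSemidef_one_sub hd hQ))
    (QWset.posDef hQ).posSemidef

theorem one_mem_QWset (hd : ∀ i, 0 < d i ∧ d i < 1) : 1 ∈ QWset d := by
  refine ⟨Matrix.isSymm_one, Matrix.PosDef.diagonal fun i => (hd i).1, ?_, ?_⟩
  · rw [← Matrix.diagonal_one, Matrix.diagonal_sub]
    exact Matrix.PosSemidef.diagonal fun i => sub_nonneg.2 (hd i).2.le
  · have : (Matrix.diagonal d)⁻¹ = Matrix.diagonal (fun i => (d i)⁻¹) := by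
      refine Matrix.inv_eq_right_inv ?_
      simp [Matrix.diagonal_mul_diagonal, (hd _).1.ne']
    rw [this, ← Matrix.diagonal_one, Matrix.diagonal_sub]
    exact Matrix.PosSemidef.diagonal fun i => sub_nonneg.2 ((one_le_inv₀ (hd i).1).2 (hd i).2.le)

/-- The variance matrix of `Y₁ + Y₂`. -/
theorem fromCols_mul_Qcorr_mul (d : Fin n → ℝ) :
    Matrix.fromCols (1 : Matrix (Fin n) (Fin n) ℝ) (1 : Matrix (Fin n) (Fin n) ℝ) * Qcorr d *
      (Matrix.fromCols (1 : Matrix (Fin n) (Fin n) ℝ) (1 : Matrix (Fin n) (Fin n) ℝ))ᵀ =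
      Matrix.diagonal fun i => 2 * (1 + d i) := by
  rw [Qcorr, Matrix.fromCols_mul_fromBlocks, Matrix.transpose_fromCols,
    Matrix.fromCols_mul_fromRows]
  simp only [Matrix.one_mul, Matrix.transpose_one, Matrix.mul_one]
  simp only [← Matrix.diagonal_one, Matrix.diagonal_add]
  congr 1
  ext i
  ring

end Matrices

/-! ### Conditional independence under the parametrized variance matrices -/

section Realization

variable {n : ℕ} {d : Fin n → ℝ} {Q : Matrix (Fin n) (Fin n) ℝ} {Ω : Type*} [MeasurableSpace Ω]
  {P : Measure Ω} {Y₁ Y₂ W : Ω → Vec (Fin n)}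

/-- The residuals of the regression on `W`, jointly with `W`. -/
theorem isG0_noise (hd : ∀ i, 0 < d i) (hQ : Q ∈ QWset d)
    (h : IsG0 (fun ω => stack (stack (Y₁ ω) (Y₂ ω)) (W ω)) (Qs d Q) P) :
    IsG0 (fun ω => stack (stack (Y₁ ω - mulVecE (diagSqrt d * Q⁻¹) (W ω))
      (Y₂ ω - mulVecE (diagSqrt d) (W ω))) (W ω)) (noiseVar d Q) P := by
  have := h.mulVecE (shear (-regr d Q))
  rw [noiseVar_eq (fun i => (hd i).le) hQ] at this
  convert this using 3 with ω
  rw [shear, mulVecE_fromBlocks_stack]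
  congr 1
  · ext (i | i) <;> simp [mulVecE_apply, stack, regr, Matrix.neg_mulVec, sub_eq_add_neg]
  · ext i; simp [mulVecE_apply]

theorem iIndepFun_noise (hd : ∀ i, 0 < d i) (hQ : Q ∈ QWset d)
    (h : IsG0 (fun ω => stack (stack (Y₁ ω) (Y₂ ω)) (W ω)) (Qs d Q) P) :
    iIndepFun ![fun ω => Y₁ ω - mulVecE (diagSqrt d * Q⁻¹) (W ω),
      fun ω => Y₂ ω - mulVecE (diagSqrt d) (W ω), W] P :=
  iIndepFun_three_of_isG0 (isG0_noise hd hQ h)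

theorem condIndepFun_of_Qs [StandardBorelSpace Ω] [IsProbabilityMeasure P]
    (hY₁ : Measurable Y₁) (hY₂ : Measurable Y₂) (hW : Measurable W)
    (hd : ∀ i, 0 < d i) (hQ : Q ∈ QWset d)
    (h : IsG0 (fun ω => stack (stack (Y₁ ω) (Y₂ ω)) (W ω)) (Qs d Q) P) :
    CondIndepFun (MeasurableSpace.comap W inferInstance) hW.comap_le Y₁ Y₂ P := by
  have hN₁ : Measurable fun ω => Y₁ ω - mulVecE (diagSqrt d * Q⁻¹) (W ω) := by fun_prop
  have hN₂ : Measurable fun ω => Y₂ ω - mulVecE (diagSqrt d) (W ω) := by fun_prop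
  have hind := (iIndepFun_noise hd hQ h).indepFun_prodMk
    (by intro i; fin_cases i <;> simpa) 2 1 0 (by decide) (by decide)
  have := condIndepFun_of_indepFun hW hN₁ hN₂ hind
    (f := fun p => p.2 + mulVecE (diagSqrt d * Q⁻¹) p.1)
    (g := fun p => p.2 + mulVecE (diagSqrt d) p.1) (by fun_prop) (by fun_prop)
  simpa using this

theorem isG0_gaussQs (hd : ∀ i, 0 < d i) (hQ : Q ∈ QWset d) :
    IsG0 (fun z : Vec ((Fin n ⊕ Fin n) ⊕ Fin n) =>
      stack (stack (fstBlock (fstBlock z)) (sndBlock (fstBlock z))) (sndBlock z)) (Qs d Q)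
      (gaussQs d Q) := by
  simp only [stack_fstBlock_sndBlock]
  exact IsG0.of_multivariateGaussian (posSemidef_Qs hd hQ)

theorem isG0_fstBlock_gaussQs (hd : ∀ i, 0 < d i) (hQ : Q ∈ QWset d) :
    IsG0 fstBlock (Qcorr d) (gaussQs d Q) := by
  have := isG0_gaussQs hd hQ
  simp only [stack_fstBlock_sndBlock (fstBlock _)] at this
  exact this.fst

theorem isCIG_gaussQs (hd : ∀ i, 0 < d i) (hQ : Q ∈ QWset d) : IsCIG (gaussQs d Q) := by
  have : IsProbabilityMeasure (gaussQs d Q) := by unfold gaussQs; infer_instance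
  refine ⟨by unfold gaussQs; infer_instance, ?_⟩
  exact condIndepFun_of_Qs (measurable_fstBlock.comp measurable_fstBlock)
    (measurable_sndBlock.comp measurable_fstBlock) measurable_sndBlock hd hQ (isG0_gaussQs hd hQ)

theorem gaussQs_mem_PCIG (hd : ∀ i, 0 < d i) (hQ : Q ∈ QWset d) :
    gaussQs d Q ∈ PCIG (multivariateGaussian 0 (Qcorr d)) n :=
  ⟨isCIG_gaussQs hd hQ, (isG0_fstBlock_gaussQs hd hQ).2.map_eq⟩

end Realization

/-! ### Information and dimension of a conditionally independent triple -/

section CIG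

variable {n : ℕ} {d : Fin n → ℝ} {κ : Type*} [Fintype κ]
  {μ : Measure (Vec ((Fin n ⊕ Fin n) ⊕ κ))}

theorem IsCIG.condIndepFun_comp [IsGaussian μ] (h : IsCIG μ) {f g : Vec (Fin n) → ℝ} (hf : Measurable f)
    (hg : Measurable g) :
    CondIndepFun (MeasurableSpace.comap (sndBlock : Vec ((Fin n ⊕ Fin n) ⊕ κ) → Vec κ)
      inferInstance) measurable_sndBlock.comap_le
      (fun z => f (fstBlock (fstBlock z))) (fun z => g (sndBlock (fstBlock z))) μ :=
  h.condIndep.comp hf hg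

/-- The information carried by a Gaussian conditionally independent `W` exceeds
`1/2 ∑ log ((1 + d i) / (1 - d i))` by at least a multiple of the mean square distance of the
conditional means of `Y₁` and `Y₂` given `W`. -/
theorem IsCIG.sum_log_le_tripleInfo (h : IsCIG μ) (hY : IsG0 fstBlock (Qcorr d) μ)
    (hd : ∀ i, 0 < d i ∧ d i < 1) :
    ENNReal.ofReal (∑ i, (1 / 2 * Real.log ((1 + d i) / (1 - d i)) +
      (∫ ω, ((μ[fun z => (fstBlock (fstBlock z)) i |
        MeasurableSpace.comap (sndBlock : Vec ((Fin n ⊕ Fin n) ⊕ κ) → Vec κ) inferInstance]) ω -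
        (μ[fun z => (sndBlock (fstBlock z)) i |
        MeasurableSpace.comap (sndBlock : Vec ((Fin n ⊕ Fin n) ⊕ κ) → Vec κ) inferInstance]) ω) ^ 2
        ∂μ) / (4 * (1 - d i)))) ≤ tripleInfo μ := by
  have := h.gaussian
  have hm1 := measurable_fstBlock (ι := Fin n ⊕ Fin n) (κ := κ)
  have hm2 := measurable_fstBlock (ι := Fin n) (κ := Fin n)
  have hm3 := measurable_sndBlock (ι := Fin n) (κ := Fin n)
  have hm4 := measurable_sndBlock (ι := Fin n ⊕ Fin n) (κ := κ)
  have hX (i : Fin n) : Measurable fun z : Vec ((Fin n ⊕ Fin n) ⊕ κ) =>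
    (fstBlock (fstBlock z)) i := by fun_prop
  have hZ (i : Fin n) : Measurable fun z : Vec ((Fin n ⊕ Fin n) ⊕ κ) =>
    (sndBlock (fstBlock z)) i := by fun_prop
  refine (sum_log_le_mutualInfo hm4 hX hZ (fun i => hY.memLp_eval (Sum.inl i))
    (fun i => hY.memLp_eval (Sum.inr i)) hd ?_ ?_ ?_ ?_ ?_).trans ?_
  · intro i
    have : _ = (1 : Matrix (Fin n) (Fin n) ℝ) i i :=
      hY.integral_mul_eval (Sum.inl i) (Sum.inl i)
    rw [Matrix.one_apply_eq] at this
    simp_rw [pow_two]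
    exact this
  · intro i
    have : _ = (1 : Matrix (Fin n) (Fin n) ℝ) i i :=
      hY.integral_mul_eval (Sum.inr i) (Sum.inr i)
    rw [Matrix.one_apply_eq] at this
    simp_rw [pow_two]
    exact this
  · intro i
    have : _ = Matrix.diagonal d i i := hY.integral_mul_eval (Sum.inl i) (Sum.inr i)
    rw [Matrix.diagonal_apply_eq] at this
    exact this
  · have h1 := hY.mulVecE (Matrix.fromCols (1 : Matrix (Fin n) (Fin n) ℝ)
      (1 : Matrix (Fin n) (Fin n) ℝ))
    rw [fromCols_mul_Qcorr_mul] at h1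
    rw [← h1.map_diagonal]
    congr 1
    ext z i
    conv_rhs => rw [← stack_fstBlock_sndBlock (fstBlock z), mulVecE_fromCols_stack]
    simp [mulVecE_apply]
  · intro i
    exact h.condIndepFun_comp (f := fun y => y i) (g := fun y => y i) (by fun_prop) (by fun_prop)
  · exact mutualInfo_comp_left_le (T := fun (y : Vec (Fin n ⊕ Fin n)) i =>
      (fstBlock y) i + (sndBlock y) i) hm1.aemeasurable hm4.aemeasurable (by fun_prop)

theorem IsCIG.le_tripleInfo (h : IsCIG μ) (hY : IsG0 fstBlock (Qcorr d) μ)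
    (hd : ∀ i, 0 < d i ∧ d i < 1) :
    ENNReal.ofReal (1 / 2 * ∑ i, Real.log ((1 + d i) / (1 - d i))) ≤ tripleInfo μ := by
  refine le_trans (ENNReal.ofReal_le_ofReal ?_) (h.sum_log_le_tripleInfo hY hd)
  rw [Finset.mul_sum]
  refine Finset.sum_le_sum fun i _ => le_add_of_nonneg_right ?_
  exact div_nonneg (integral_nonneg fun z => sq_nonneg _) (by linarith [hd i])

/-- The information strictly exceeds the lower bound if `Y₁` and `Y₂` have different mixed moments
with `W`: the gap in the bound vanishes only if their conditional means given `W` agree. -/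
theorem IsCIG.lt_tripleInfo_of_integral_ne (h : IsCIG μ) (hY : IsG0 fstBlock (Qcorr d) μ)
    (hd : ∀ i, 0 < d i ∧ d i < 1) {i : Fin n} {k : κ}
    (hW : MemLp (fun z : Vec ((Fin n ⊕ Fin n) ⊕ κ) => (sndBlock z) k) 2 μ)
    (hne : ∫ z, (sndBlock z) k * (fstBlock (fstBlock z)) i ∂μ ≠
      ∫ z, (sndBlock z) k * (sndBlock (fstBlock z)) i ∂μ) :
    ENNReal.ofReal (1 / 2 * ∑ i, Real.log ((1 + d i) / (1 - d i))) < tripleInfo μ := by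
  have := h.gaussian
  have hX (i) : MemLp (fun z : Vec ((Fin n ⊕ Fin n) ⊕ κ) => (fstBlock (fstBlock z)) i) 2 μ :=
    hY.memLp_eval (Sum.inl i)
  have hZ (i) : MemLp (fun z : Vec ((Fin n ⊕ Fin n) ⊕ κ) => (sndBlock (fstBlock z)) i) 2 μ :=
    hY.memLp_eval (Sum.inr i)
  refine lt_of_lt_of_le ?_ (h.sum_log_le_tripleInfo hY hd)
  have hlog (i) : 0 < Real.log ((1 + d i) / (1 - d i)) := by
    refine Real.log_pos ?_
    rw [one_lt_div] <;> linarith [hd i]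
  refine (ENNReal.ofReal_lt_ofReal_iff_of_nonneg ?_).2 ?_
  · exact mul_nonneg (by norm_num) (Finset.sum_nonneg fun i _ => (hlog i).le)
  rw [Finset.mul_sum]
  refine Finset.sum_lt_sum (fun i _ => le_add_of_nonneg_right ?_)
    ⟨i, Finset.mem_univ i, lt_add_of_pos_right _ (div_pos ?_ (by linarith [hd i]))⟩
  · exact div_nonneg (integral_nonneg fun z => sq_nonneg _) (by linarith [hd i])
  refine lt_of_le_of_ne (integral_nonneg fun z => sq_nonneg _) fun h0 => hne ?_
  have h1 := (integral_eq_zero_iff_of_nonneg (fun z => sq_nonneg _)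
    (((hX i).condExp one_le_two).sub ((hZ i).condExp one_le_two)).integrable_sq).1 h0.symm
  have hWm : StronglyMeasurable[MeasurableSpace.comap
      (sndBlock : Vec ((Fin n ⊕ Fin n) ⊕ κ) → Vec κ) inferInstance]
      (fun z : Vec ((Fin n ⊕ Fin n) ⊕ κ) => (sndBlock z) k) := by
    refine Measurable.stronglyMeasurable ?_
    exact Measurable.comp (g := fun w : Vec κ => w k) (by fun_prop) (comap_measurable _)
  rw [← integral_mul_condExp measurable_sndBlock.comap_le (hX i) hWm hW,
    ← integral_mul_condExp measurable_sndBlock.comap_le (hZ i) hWm hW]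
  refine integral_congr_ae ?_
  filter_upwards [h1] with z hz
  have : _ - _ = (0 : ℝ) := pow_eq_zero_iff two_ne_zero |>.1 hz
  rw [sub_eq_zero.1 this]

/-- If `W` has fewer entries than `Y₁`, some nonzero linear form of `Y₁` is uncorrelated with, hence
independent of, `W`; conditional independence makes it uncorrelated with `Y₂`, contradicting
the invertibility of `D`. -/
theorem IsCIG.le_card (h : IsCIG μ) (hY : IsG0 fstBlock (Qcorr d) μ)
    (hd : ∀ i, d i ≠ 0) : n ≤ Fintype.card κ := by
  classical
  by_contra! hlt
  have := h.gaussian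
  have hid : HasGaussianLaw (id : Vec ((Fin n ⊕ Fin n) ⊕ κ) → _) μ := IsGaussian.hasGaussianLaw_id
  have hm1 := measurable_fstBlock (ι := Fin n ⊕ Fin n) (κ := κ)
  have hm2 := measurable_fstBlock (ι := Fin n) (κ := Fin n)
  have hm3 := measurable_sndBlock (ι := Fin n) (κ := Fin n)
  have hm4 := measurable_sndBlock (ι := Fin n ⊕ Fin n) (κ := κ)
  have hX (i) : MemLp (fun z : Vec ((Fin n ⊕ Fin n) ⊕ κ) => (fstBlock (fstBlock z)) i) 2 μ :=
    hY.memLp_eval (Sum.inl i)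
  have hZ (i) : MemLp (fun z : Vec ((Fin n ⊕ Fin n) ⊕ κ) => (sndBlock (fstBlock z)) i) 2 μ :=
    hY.memLp_eval (Sum.inr i)
  have hW (k) : MemLp (fun z : Vec ((Fin n ⊕ Fin n) ⊕ κ) => (sndBlock z) k) 2 μ :=
    (hid.map_fun (EuclideanSpace.proj (𝕜 := ℝ) (Sum.inr k))).memLp_two
  let c : Matrix κ (Fin n) ℝ := fun k i =>
    cov[fun z => (fstBlock (fstBlock z)) i, fun z => (sndBlock z) k; μ]
  -- The covariances of `Y₁` with `W` form a matrix with fewer rows than columns.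
  obtain ⟨x, hx, hx0⟩ : ∃ x : Fin n → ℝ, c *ᵥ x = 0 ∧ x ≠ 0 := by
    have := LinearMap.ker_ne_bot_of_finrank_lt (f := c.mulVecLin) (by simpa using hlt)
    obtain ⟨x, hx, hx0⟩ := (Submodule.ne_bot_iff _).1 this
    exact ⟨x, hx, hx0⟩
  let T : Vec ((Fin n ⊕ Fin n) ⊕ κ) → ℝ := fun z => ∑ i, x i * (fstBlock (fstBlock z)) i
  have hT : MemLp T 2 μ := memLp_finsetSum _ fun i _ => (hX i).const_mul _
  have hTm : Measurable T := by fun_prop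
  have hcov (k) : cov[T, fun z => (sndBlock z) k; μ] = 0 := by
    have := congr_fun hx k
    simp only [Matrix.mulVec, dotProduct, c, Pi.zero_apply] at this
    rw [← this, covariance_fun_sum_left (fun i => (hX i).const_mul _) (hW k)]
    exact Finset.sum_congr rfl fun i _ => by rw [covariance_const_mul_left, mul_comm]
  have hgauss : HasGaussianLaw (fun z => (T z, sndBlock z)) μ := by
    let L : Vec ((Fin n ⊕ Fin n) ⊕ κ) →L[ℝ] ℝ :=
      ∑ i, x i • EuclideanSpace.proj (𝕜 := ℝ) (Sum.inl (Sum.inl i))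
    refine (hid.map_fun (L.prod (mulVecE (Matrix.fromCols 0 1)))).congr (ae_of_all _ fun z => ?_)
    have : L z = T z := by simp [L, T, fstBlock]
    simp [this, ← sndBlock_eq_mulVecE]
  have hind : IndepFun T sndBlock μ := by
    refine HasGaussianLaw.indepFun_of_covariance_inner hgauss fun a b => ?_
    simp only [PiLp.inner_apply]
    rw [covariance_fun_sum_right ?_ ?_]
    · refine Finset.sum_eq_zero fun k _ => ?_
      simp [covariance_mul_const_left, covariance_mul_const_right, hcov]
    · exact fun k => by simpa using (hW k).mul_const _
    · simpa using hT.mul_const _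
  have hT0 : ∫ z, T z ∂μ = 0 := by
    rw [integral_finsetSum _ fun i _ => ((hX i).integrable one_le_two).const_mul _]
    refine Finset.sum_eq_zero fun i _ => ?_
    rw [integral_const_mul]
    have := hY.integral_eval (Sum.inl i)
    exact mul_eq_zero_of_right _ this
  have hTc : μ[T | MeasurableSpace.comap (sndBlock : Vec ((Fin n ⊕ Fin n) ⊕ κ) → Vec κ)
      inferInstance] =ᵐ[μ] fun _ => 0 := by
    have := condExp_indep_eq hTm.comap_le hm4.comap_le
      (f := T) (comap_measurable T).stronglyMeasurable hind
    rwa [hT0] at this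
  refine hx0 (funext fun j => ?_)
  have h1 := CondIndepFun.integral_mul_eq hTm (by fun_prop) hT (hZ j)
    (h.condIndepFun_comp (f := fun y => ∑ i, x i * y i) (g := fun y => y j) (by fun_prop)
      (by fun_prop))
  have h2 : ∫ z, T z * (sndBlock (fstBlock z)) j ∂μ = x j * d j := by
    have e (z) : T z * (sndBlock (fstBlock z)) j =
      ∑ i, x i * ((fstBlock (fstBlock z)) i * (sndBlock (fstBlock z)) j) := by
      simp only [T, Finset.sum_mul, mul_assoc]
    simp_rw [e]
    have hi (i) : Integrable (fun z : Vec ((Fin n ⊕ Fin n) ⊕ κ) =>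
        x i * ((fstBlock (fstBlock z)) i * (sndBlock (fstBlock z)) j)) μ :=
      ((hX i).integrable_mul (hZ j)).const_mul _
    rw [integral_finsetSum _ fun i _ => hi i]
    have e2 (i) : ∫ z, (fstBlock (fstBlock z)) i * (sndBlock (fstBlock z)) j ∂μ =
        Matrix.diagonal d i j := hY.integral_mul_eval (Sum.inl i) (Sum.inr j)
    simp_rw [integral_const_mul, e2, Matrix.diagonal_apply]
    simp
  have h3 : ∫ z, T z * (sndBlock (fstBlock z)) j ∂μ = 0 := by
    rw [h1]
    refine integral_eq_zero_of_ae ?_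
    filter_upwards [hTc] with z hz
    simp [hz]
  rw [h3] at h2
  simpa [hd j] using h2.symm

end CIG

/-! ### Attainment of the lower bound -/

section MutualInfo

variable {Ω α β γ ε : Type*} [MeasurableSpace Ω] {P : Measure Ω} [IsProbabilityMeasure P]
  [MeasurableSpace α] [MeasurableSpace β] [MeasurableSpace γ] [MeasurableSpace ε]

/-- A component `B` independent of `(A, W)` adds no information on `W`. -/
theorem mutualInfo_le_of_indepFun {A : Ω → α} {B : Ω → γ} {W : Ω → β} (hA : Measurable A)
    (hB : Measurable B) (hW : Measurable W) (h : IndepFun (fun ω => (A ω, W ω)) B P)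
    {T : α × γ → ε} (hT : Measurable T) :
    mutualInfo (fun ω => T (A ω, B ω)) W P ≤ mutualInfo A W P := by
  have := Measure.isProbabilityMeasure_map (μ := P) hA.aemeasurable
  have := Measure.isProbabilityMeasure_map (μ := P) hB.aemeasurable
  have := Measure.isProbabilityMeasure_map (μ := P) hW.aemeasurable
  have := Measure.isProbabilityMeasure_map (μ := P) (hA.prodMk hW).aemeasurable
  have hS : Measurable fun p : (α × β) × γ => (T (p.1.1, p.2), p.1.2) := by fun_prop
  have h1 := (indepFun_iff_map_prod_eq_prod_map_map (hA.prodMk hW).aemeasurable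
    hB.aemeasurable).1 h
  have h2 := (indepFun_iff_map_prod_eq_prod_map_map hA.aemeasurable hB.aemeasurable).1
    (h.comp measurable_fst measurable_id)
  have h3 : P.map (fun ω => (T (A ω, B ω), W ω)) =
      ((P.map fun ω => (A ω, W ω)).prod (P.map B)).map
        (fun p : (α × β) × γ => (T (p.1.1, p.2), p.1.2)) := by
    rw [← h1, Measure.map_map hS (by fun_prop)]
    rfl
  have h4 : (P.map fun ω => T (A ω, B ω)).prod (P.map W) =
      (((P.map A).prod (P.map W)).prod (P.map B)).map
        (fun p : (α × β) × γ => (T (p.1.1, p.2), p.1.2)) := by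
    have h5 : P.map (fun ω => T (A ω, B ω)) = ((P.map A).prod (P.map B)).map T := by
      rw [← h2, Measure.map_map hT (by fun_prop)]
      rfl
    rw [h5]
    have := Measure.isProbabilityMeasure_map (μ := (P.map A).prod (P.map B)) hT.aemeasurable
    refine Measure.ext_of_lintegral _ fun g hg => ?_
    rw [lintegral_prod_symm _ (by fun_prop), lintegral_map hg hS, lintegral_prod _ (by fun_prop),
      lintegral_prod_symm _ (Measurable.aemeasurable ?_)]
    · refine lintegral_congr fun w => ?_
      rw [lintegral_map (by fun_prop) hT, lintegral_prod _ (by fun_prop)]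
    · exact Measurable.lintegral_prod_right' (f := fun p : (α × β) × γ =>
        g (T (p.1.1, p.2), p.1.2)) (by fun_prop)
  unfold mutualInfo
  rw [h3, h4]
  exact klDiv_map_prod_const_le _ hS

omit [IsProbabilityMeasure P] in
theorem mutualInfo_map {Z : Ω → α} (hZ : Measurable Z) {f : α → β} {g : α → γ}
    (hf : Measurable f) (hg : Measurable g) :
    mutualInfo f g (P.map Z) = mutualInfo (fun ω => f (Z ω)) (fun ω => g (Z ω)) P := by
  unfold mutualInfo
  rw [Measure.map_map (by fun_prop) hZ, Measure.map_map hf hZ, Measure.map_map hg hZ]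
  rfl

end MutualInfo

section Upper

variable {n : ℕ} {d : Fin n → ℝ} {Ω : Type*} [MeasurableSpace Ω]
  {P : Measure Ω} {Y₁ Y₂ W : Ω → Vec (Fin n)}

theorem noiseVar_one (hd : ∀ i, 0 ≤ d i) : noiseVar d 1 =
    Matrix.fromBlocks (Matrix.fromBlocks (1 - Matrix.diagonal d) 0 0 (1 - Matrix.diagonal d))
      0 0 1 := by
  simp [noiseVar, diagSqrt_mul_diagSqrt hd]

theorem isG0_noise_one (hd : ∀ i, 0 < d i ∧ d i < 1)
    (h : IsG0 (fun ω => stack (stack (Y₁ ω) (Y₂ ω)) (W ω)) (Qs d 1) P) :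
    IsG0 (fun ω => stack (stack (Y₁ ω - mulVecE (diagSqrt d) (W ω))
      (Y₂ ω - mulVecE (diagSqrt d) (W ω))) (W ω)) (Matrix.fromBlocks
        (Matrix.fromBlocks (1 - Matrix.diagonal d) 0 0 (1 - Matrix.diagonal d)) 0 0 1) P := by
  have := isG0_noise (fun i => (hd i).1) (one_mem_QWset hd) h
  rwa [noiseVar_one fun i => (hd i).1.le, inv_one, Matrix.mul_one] at this

/-- The sum and the difference of the two residuals, jointly with `W`. -/
theorem isG0_sum_diff (hd : ∀ i, 0 < d i ∧ d i < 1)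
    (h : IsG0 (fun ω => stack (stack (Y₁ ω) (Y₂ ω)) (W ω)) (Qs d 1) P) :
    IsG0 (fun ω => stack (stack (Y₁ ω + Y₂ ω - (2 : ℝ) • mulVecE (diagSqrt d) (W ω))
      (Y₁ ω - Y₂ ω)) (W ω)) (Matrix.fromBlocks
        (Matrix.fromBlocks (Matrix.diagonal fun i => 2 * (1 - d i)) 0 0
          (Matrix.diagonal fun i => 2 * (1 - d i))) 0 0 1) P := by
  have h1 := (isG0_noise_one hd h).mulVecE (Matrix.fromBlocks (Matrix.fromBlocks
    (1 : Matrix (Fin n) (Fin n) ℝ) (1 : Matrix (Fin n) (Fin n) ℝ)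
    (1 : Matrix (Fin n) (Fin n) ℝ) (-1 : Matrix (Fin n) (Fin n) ℝ)) 0 0
    (1 : Matrix (Fin n) (Fin n) ℝ))
  convert h1 using 1
  · ext ω i
    rw [mulVecE_fromBlocks_stack, mulVecE_fromBlocks_stack]
    rcases i with (i | i) | i
    · simp [stack, mulVecE_apply]; ring
    · simp [stack, mulVecE_apply, Matrix.neg_mulVec]
    · simp [stack, mulVecE_apply]
  · have e : (1 - Matrix.diagonal d) + (1 - Matrix.diagonal d) =
        Matrix.diagonal fun i => 2 * (1 - d i) := by
      rw [← Matrix.diagonal_one, Matrix.diagonal_sub, Matrix.diagonal_add]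
      congr 1; ext i; ring
    simp only [Matrix.fromBlocks_transpose, Matrix.fromBlocks_multiply, Matrix.one_mul,
      Matrix.mul_one, Matrix.zero_mul, Matrix.mul_zero, add_zero, zero_add, Matrix.transpose_one,
      Matrix.transpose_zero, Matrix.transpose_neg, Matrix.neg_mul, Matrix.mul_neg, neg_neg, e]
    simp

/-- Under `Qs d 1` the lower bound on the information is attained: the difference `Y₁ - Y₂` is
independent of `(Y₁ + Y₂, W)`, and the conditional law of `Y₁ + Y₂` given `W` is the one
used in the lower bound. -/
theorem mutualInfo_le_sum_log [IsProbabilityMeasure P] (hd : ∀ i, 0 < d i ∧ d i < 1)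
    (hY₁ : Measurable Y₁) (hY₂ : Measurable Y₂) (hW : Measurable W)
    (h : IsG0 (fun ω => stack (stack (Y₁ ω) (Y₂ ω)) (W ω)) (Qs d 1) P) :
    mutualInfo (fun ω => stack (Y₁ ω) (Y₂ ω)) W P ≤
      ENNReal.ofReal (1 / 2 * ∑ i, Real.log ((1 + d i) / (1 - d i))) := by
  have hs : ∀ i, 0 < 2 * (1 - d i) := fun i => by linarith [hd i]
  have hv : ∀ i, 0 < 2 * (1 + d i) := fun i => by linarith [hd i]
  have hXBW := isG0_sum_diff hd h
  have hm : Measurable fun (w : Vec (Fin n)) i => 2 * √(d i) * w i := by fun_prop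
  have hX : Measurable fun ω => (Y₁ ω + Y₂ ω - (2 : ℝ) • mulVecE (diagSqrt d) (W ω)) := by
    fun_prop
  have hX' : Measurable fun ω => (Y₁ ω + Y₂ ω - (2 : ℝ) • mulVecE (diagSqrt d) (W ω)).ofLp := by
    fun_prop
  have hB : Measurable fun ω => Y₁ ω - Y₂ ω := by fun_prop
  have hA : Measurable fun ω i => (Y₁ ω) i + (Y₂ ω) i := by fun_prop
  have := Measure.isProbabilityMeasure_map (μ := P) hW.aemeasurable
  have := Measure.isProbabilityMeasure_map (μ := P) (hA.prodMk hW).aemeasurable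
  have hi := iIndepFun_three_of_isG0 hXBW
  have hind1 := hi.indepFun (i := 0) (j := 2) (by decide)
  have hind2 := hi.indepFun_prodMk (by intro i; fin_cases i <;> simpa) 0 2 1 (by decide) (by decide)
  have e (ω) (i) : (Y₁ ω) i + (Y₂ ω) i = 2 * √(d i) * (W ω) i +
      (Y₁ ω + Y₂ ω - (2 : ℝ) • mulVecE (diagSqrt d) (W ω)).ofLp i := by
    simp [mulVecE_apply, diagSqrt, Matrix.mulVec_diagonal]; ring
  have hindB : IndepFun (fun ω => ((fun i => (Y₁ ω) i + (Y₂ ω) i), W ω)) (fun ω => Y₁ ω - Y₂ ω)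
      P := by
    have := hind2.comp (φ := fun p : Vec (Fin n) × Vec (Fin n) =>
      ((fun i => 2 * √(d i) * p.2 i + p.1 i), p.2)) (ψ := id) (by fun_prop) measurable_id
    have e0 : (fun ω => ((fun i => (Y₁ ω) i + (Y₂ ω) i), W ω)) =
        fun ω => ((fun i => 2 * √(d i) * (W ω) i +
          (Y₁ ω + Y₂ ω - (2 : ℝ) • mulVecE (diagSqrt d) (W ω)).ofLp i), W ω) :=
      funext fun ω => Prod.ext (funext (e ω)) rfl
    rw [e0]
    exact this
  -- `(Y₁, Y₂)` is recovered from the sum and the difference.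
  have hle := mutualInfo_le_of_indepFun hA hB hW hindB
    (T := fun p : (Fin n → ℝ) × Vec (Fin n) => stack (WithLp.toLp 2 fun i => (p.1 i + p.2 i) / 2)
      (WithLp.toLp 2 fun i => (p.1 i - p.2 i) / 2))
    (measurable_stack.comp (by fun_prop : Measurable fun p : (Fin n → ℝ) × Vec (Fin n) =>
      ((WithLp.toLp 2 fun i => (p.1 i + p.2 i) / 2 : Vec (Fin n)),
      (WithLp.toLp 2 fun i => (p.1 i - p.2 i) / 2 : Vec (Fin n)))))
  have e2 (ω) : stack (WithLp.toLp 2 fun i => ((Y₁ ω) i + (Y₂ ω) i + (Y₁ ω - Y₂ ω) i) / 2)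
      (WithLp.toLp 2 fun i => ((Y₁ ω) i + (Y₂ ω) i - (Y₁ ω - Y₂ ω) i) / 2) =
      stack (Y₁ ω) (Y₂ ω) := by
    congr 1 <;> · ext i; simp
  simp only [e2] at hle
  refine hle.trans (le_of_eq ?_)
  have hAlaw : P.map (fun ω i => (Y₁ ω) i + (Y₂ ω) i) =
      Measure.pi fun i => gaussianReal 0 (2 * (1 + d i)).toNNReal := by
    have h1 := h.fst.mulVecE (Matrix.fromCols (1 : Matrix (Fin n) (Fin n) ℝ)
      (1 : Matrix (Fin n) (Fin n) ℝ))
    rw [fromCols_mul_Qcorr_mul] at h1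
    rw [← h1.map_diagonal]
    congr 1
    ext ω i
    rw [mulVecE_fromCols_stack]
    simp [mulVecE_apply]
  have htilt := map_add_prodMk_eq_tilted hm hs hv hX' hW hXBW.fst.fst.map_diagonal
    (hind1.comp (φ := WithLp.ofLp) (ψ := id) (by fun_prop) measurable_id)
  have e3 (ω) : ((fun i => 2 * √(d i) * (W ω) i) +
      (Y₁ ω + Y₂ ω - (2 : ℝ) • mulVecE (diagSqrt d) (W ω)).ofLp) =
      fun i => (Y₁ ω) i + (Y₂ ω) i := by
    ext i; exact (e ω i).symm
  simp only [e3] at htilt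
  have hA2 (i : Fin n) := memLp_of_map_eq_pi hA hAlaw hv i
  have hX2 (i : Fin n) := memLp_of_map_eq_pi hX' hXBW.fst.fst.map_diagonal hs i
  have hW2 (i : Fin n) : MemLp (fun ω => 2 * √(d i) * (W ω) i) 2 P :=
    (h.snd.memLp_eval i).const_mul _
  have hmeas := measurable_logDensity (s := fun i => 2 * (1 - d i)) (v := fun i => 2 * (1 + d i)) hm
  unfold mutualInfo
  rw [hAlaw, klDiv_tilted (integrable_exp_logDensity hm hs hv _)
    (integral_exp_logDensity hm hs hv _) htilt]
  · rw [integral_map (by fun_prop) (by fun_prop),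
      integral_logDensity (m := fun (w : Vec (Fin n)) i => 2 * √(d i) * w i)
        (fun i => (hA2 i).1) hW2,
      Finset.mul_sum]
    congr 1
    refine Finset.sum_congr rfl fun i _ => ?_
    have e4 (ω) : (Y₁ ω) i + (Y₂ ω) i - 2 * √(d i) * (W ω) i =
      (Y₁ ω + Y₂ ω - (2 : ℝ) • mulVecE (diagSqrt d) (W ω)).ofLp i := by rw [e]; ring
    simp_rw [e4]
    rw [(hA2 i).2, (hX2 i).2, mul_div_mul_left _ _ two_ne_zero]
    have := (hs i).ne'
    have := (hv i).ne'
    have : 1 - d i ≠ 0 := by linarith [hd i]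
    have : 1 + d i ≠ 0 := by linarith [hd i]
    field_simp
    ring
  · rw [integrable_map_measure (by fun_prop) (by fun_prop)]
    exact integrable_logDensity (m := fun (w : Vec (Fin n)) i => 2 * √(d i) * w i)
        (fun i => (hA2 i).1) hW2 (fun i => 2 * (1 - d i))
      (fun i => 2 * (1 + d i))

end Upper

/-! ### The common information -/

section Value

variable {n : ℕ} {d : Fin n → ℝ}

theorem tripleInfo_gaussQs_one (hd : ∀ i, 0 < d i ∧ d i < 1) :
    tripleInfo (gaussQs d 1) =
      ENNReal.ofReal (1 / 2 * ∑ i, Real.log ((1 + d i) / (1 - d i))) := by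
  have hd0 : ∀ i, 0 < d i := fun i => (hd i).1
  have hQ := one_mem_QWset hd
  have : IsProbabilityMeasure (gaussQs d 1) := by unfold gaussQs; infer_instance
  refine le_antisymm ?_ ((isCIG_gaussQs hd0 hQ).le_tripleInfo (isG0_fstBlock_gaussQs hd0 hQ) hd)
  have := mutualInfo_le_sum_log hd (measurable_fstBlock.comp measurable_fstBlock)
    (measurable_sndBlock.comp measurable_fstBlock) measurable_sndBlock (isG0_gaussQs hd0 hQ)
  simp only [Function.comp_apply, stack_fstBlock_sndBlock] at this
  exact this

/-- Under `Qs d Q` the covariances of `Y₁` and `Y₂` with `W` are `D^{1/2}` and `D^{1/2} Q`, which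
differ unless `Q = 1`. -/
theorem tripleInfo_gaussQs_one_lt (hd : ∀ i, 0 < d i ∧ d i < 1) {Q : Matrix (Fin n) (Fin n) ℝ}
    (hQ : Q ∈ QWset d) (hne : Q ≠ 1) : tripleInfo (gaussQs d 1) < tripleInfo (gaussQs d Q) := by
  have hd0 : ∀ i, 0 < d i := fun i => (hd i).1
  rw [tripleInfo_gaussQs_one hd]
  obtain ⟨k, i, hik⟩ : ∃ k i, (1 : Matrix (Fin n) (Fin n) ℝ) k i ≠ Q k i := by
    by_contra! h
    exact hne (Matrix.ext fun k i => (h k i).symm)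
  have hZ := isG0_gaussQs hd0 hQ
  simp only [stack_fstBlock_sndBlock] at hZ
  refine (isCIG_gaussQs hd0 hQ).lt_tripleInfo_of_integral_ne (isG0_fstBlock_gaussQs hd0 hQ) hd
    (i := i) (k := k) (hZ.memLp_eval (Sum.inr k)) ?_
  have h1 : _ = (diagSqrt d) k i := hZ.integral_mul_eval (Sum.inr k) (Sum.inl (Sum.inl i))
  have h2 : _ = (Q * diagSqrt d) k i := hZ.integral_mul_eval (Sum.inr k) (Sum.inl (Sum.inr i))
  intro h
  have h3 : (diagSqrt d) k i = (Q * diagSqrt d) k i := h1.symm.trans (h.trans h2)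
  rw [diagSqrt, Matrix.mul_diagonal, ← Matrix.one_mul (Matrix.diagonal _),
    Matrix.mul_diagonal] at h3
  exact hik (mul_right_cancel₀ (Real.sqrt_pos.2 (hd0 i)).ne' h3)

theorem isG0_fstBlock_of_mem_PCIG {m : ℕ} (hQ : (Qcorr d).PosSemidef)
    {μ : Measure (Vec ((Fin n ⊕ Fin n) ⊕ Fin m))}
    (h : μ ∈ PCIG (multivariateGaussian 0 (Qcorr d)) m) : IsG0 fstBlock (Qcorr d) μ :=
  ⟨hQ, measurable_fstBlock.aemeasurable, h.2⟩

theorem wynerCLaw_eq (hd : ∀ i, 0 < d i ∧ d i < 1) (hQ : (Qcorr d).PosSemidef) :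
    wynerCLaw (multivariateGaussian 0 (Qcorr d)) =
      ENNReal.ofReal (1 / 2 * ∑ i, Real.log ((1 + d i) / (1 - d i))) := by
  refine le_antisymm ?_ ?_
  · rw [← tripleInfo_gaussQs_one hd]
    exact iInf₂_le_of_le n _ (iInf_le_of_le
      (gaussQs_mem_PCIG (fun i => (hd i).1) (one_mem_QWset hd)) le_rfl)
  · exact le_iInf fun m => le_iInf₂ fun μ hμ =>
      hμ.1.le_tripleInfo (isG0_fstBlock_of_mem_PCIG hQ hμ) hd

theorem Pci_subset_PCIGmin (hd : ∀ i, 0 < d i ∧ d i < 1) (hQ : (Qcorr d).PosSemidef) :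
    Pci d ⊆ PCIGmin (multivariateGaussian 0 (Qcorr d)) n := by
  rintro μ ⟨Q, hQ', rfl⟩
  refine ⟨gaussQs_mem_PCIG (fun i => (hd i).1) hQ', fun m hm ⟨μ₁, hμ₁⟩ => ?_⟩
  have := hμ₁.1.le_card (isG0_fstBlock_of_mem_PCIG hQ hμ₁) fun i => (hd i).1.ne'
  simp at this
  omega

end Value

/-! ### The optimal realization -/

section Optimal

variable {n : ℕ} {d : Fin n → ℝ} {Ω : Type*} [MeasurableSpace Ω]
  {P : Measure Ω} {Y₁ Y₂ V : Ω → Vec (Fin n)}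

theorem L12_eq (hd : ∀ i, 0 < d i) : L12 d = Matrix.diagonal fun i => √(d i) / (1 + d i) := by
  have : (1 + Matrix.diagonal d)⁻¹ = Matrix.diagonal fun i => (1 + d i)⁻¹ := by
    refine Matrix.inv_eq_right_inv ?_
    have h (i) : 1 + d i ≠ 0 := by linarith [hd i]
    rw [← Matrix.diagonal_one, Matrix.diagonal_add, Matrix.diagonal_mul_diagonal]
    simp [h]
  rw [L12, this, diagSqrt, Matrix.diagonal_mul_diagonal]
  rfl

theorem L3_eq (hd : ∀ i, 0 < d i) :
    L3 d = Matrix.diagonal fun i => √(1 - d i) / √(1 + d i) := by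
  have : (diagSqrt fun i => 1 + d i)⁻¹ = Matrix.diagonal fun i => (√(1 + d i))⁻¹ := by
    refine Matrix.inv_eq_right_inv ?_
    have h (i) : √(1 + d i) ≠ 0 := (Real.sqrt_pos.2 (by linarith [hd i])).ne'
    rw [diagSqrt, Matrix.diagonal_mul_diagonal]
    simp [h]
  rw [L3, this, diagSqrt, Matrix.diagonal_mul_diagonal]
  rfl

theorem app_eq_mulVecE (A : Matrix (Fin n) (Fin n) ℝ) (x : Vec (Fin n)) :
    app A x = mulVecE A x := rfl

theorem indepFun_of_isExtraNoise (hV : IsExtraNoise Y₁ Y₂ V P) :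
    IndepFun (fun ω => stack (Y₁ ω) (Y₂ ω)) V P := by
  refine (indep_of_indep_of_le_right hV.indep ?_).symm
  have h : Measurable[MeasurableSpace.comap Y₁ inferInstance ⊔
      MeasurableSpace.comap Y₂ inferInstance] fun ω => (Y₁ ω, Y₂ ω) :=
    ((comap_measurable Y₁).mono le_sup_left le_rfl).prodMk
      ((comap_measurable Y₂).mono le_sup_right le_rfl)
  exact (measurable_stack.comp h).comap_le

/-- The joint law of `Y₁`, `Y₂` and `W* = L₁ Y₁ + L₂ Y₂ + L₃ V`, as a linear image of `(Y₁, Y₂, V)`. -/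
theorem isG0_Wstar (hd : ∀ i, 0 < d i ∧ d i < 1) (hY : IsCorrPair d Y₁ Y₂ P)
    (hV : IsExtraNoise Y₁ Y₂ V P) :
    IsG0 (fun ω => stack (stack (Y₁ ω) (Y₂ ω)) (Wstar d Y₁ Y₂ V ω)) (Qs d 1) P := by
  have h0 := hY.law.stack_of_indepFun hV.law (indepFun_of_isExtraNoise hV)
  have h1 := h0.mulVecE (Matrix.fromBlocks (1 : Matrix (Fin n ⊕ Fin n) (Fin n ⊕ Fin n) ℝ) 0
    (Matrix.fromCols (L12 d) (L12 d)) (L3 d))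
  convert h1 using 1
  · ext ω : 1
    rw [mulVecE_fromBlocks_stack, mulVecE_fromCols_stack]
    simp [Wstar, app_eq_mulVecE, mulVecE_apply]
  · have hd0 : ∀ i, 0 < d i := fun i => (hd i).1
    have e1 : L12 d + L12 d * Matrix.diagonal d = diagSqrt d := by
      rw [L12_eq hd0, diagSqrt, Matrix.diagonal_mul_diagonal, Matrix.diagonal_add]
      congr 1; ext i
      have : 1 + d i ≠ 0 := by linarith [hd i]
      field_simp
    have e2 : L12 d * Matrix.diagonal d + L12 d = diagSqrt d := by rw [add_comm, e1]
    have t1 : (L12 d)ᵀ = L12 d := by simp [L12_eq hd0]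
    have t3 : (L3 d)ᵀ = L3 d := by simp [L3_eq hd0]
    have e3 : L12 d + Matrix.diagonal d * L12 d = diagSqrt d := by
      have := congrArg Matrix.transpose e1
      simpa [t1, transpose_diagSqrt] using this
    have e3' : Matrix.diagonal d * L12 d + L12 d = diagSqrt d := by rw [add_comm, e3]
    have e4 : diagSqrt d * L12 d + diagSqrt d * L12 d + L3 d * L3 d = 1 := by
      rw [L12_eq hd0, L3_eq hd0, diagSqrt, Matrix.diagonal_mul_diagonal,
        Matrix.diagonal_mul_diagonal, Matrix.diagonal_add, Matrix.diagonal_add,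
        ← Matrix.diagonal_one]
      congr 1; ext i
      have h1 : 1 + d i ≠ 0 := by linarith [hd i]
      rw [div_mul_div_comm, Real.mul_self_sqrt (by linarith [hd i]),
        Real.mul_self_sqrt (by linarith [hd i]), ← mul_div_assoc, Real.mul_self_sqrt (hd0 i).le]
      field_simp
      ring
    rw [Matrix.fromBlocks_transpose, Matrix.fromBlocks_multiply, Matrix.fromBlocks_multiply,
      Matrix.transpose_fromCols, t1, t3, Qs]
    simp only [Matrix.one_mul, Matrix.mul_zero, Matrix.zero_mul, add_zero, zero_add,
      Matrix.transpose_one, Matrix.transpose_zero, Matrix.mul_one]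
    congr 1
    · rw [Qcorr, Matrix.fromBlocks_mul_fromRows]
      simp [e3, e3']
    · rw [Qcorr, Matrix.fromCols_mul_fromBlocks]
      simp [e1, e2]
    · rw [Qcorr, Matrix.fromCols_mul_fromBlocks, Matrix.fromCols_mul_fromRows]
      simp [e1, e2, e4]

end Optimal
end GaussianCI

open GaussianCI
theorem mainTheorem3 (n : ℕ) (hn : 0 < n) (d : Fin n → ℝ) (hd : ∀ i, 0 < d i ∧ d i < 1)
    {Ω : Type*} [MeasurableSpace Ω] (P : Measure Ω) [IsProbabilityMeasure P]
    (Y₁ Y₂ : Ω → Vec (Fin n)) (hY : IsCorrPair d Y₁ Y₂ P) :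
    -- the value of the common information
    (wynerC Y₁ Y₂ P = ENNReal.ofReal (1 / 2 * ∑ i, Real.log ((1 + d i) / (1 - d i))) ∧
      wynerC Y₁ Y₂ P = ENNReal.ofReal (1 / 2 * ∑ i, Real.log (1 + 2 * d i / (1 - d i))) ∧
      0 < wynerC Y₁ Y₂ P ∧ wynerC Y₁ Y₂ P < ∞) ∧
    -- the parametrized family consists of minimal Gaussian realizations; the minimum of the
    -- mutual information over it is the common information, attained at the identity only
    (Pci d ⊆ PCIGmin (P.map (fun ω => stack (Y₁ ω) (Y₂ ω))) n ∧
      (1 : Matrix (Fin n) (Fin n) ℝ) ∈ QWset d ∧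
      tripleInfo (gaussQs d 1) = wynerC Y₁ Y₂ P ∧
      (∀ Q ∈ QWset d, Q ≠ 1 → tripleInfo (gaussQs d 1) < tripleInfo (gaussQs d Q))) ∧
    -- the matrices of the optimal realization are diagonal
    ((L12 d).IsDiag ∧ (L3 d).IsDiag) ∧
    -- the optimal realization
    (∀ V : Ω → Vec (Fin n), IsExtraNoise Y₁ Y₂ V P →
      ∀ W Z₁ Z₂ : Ω → Vec (Fin n),
        W = Wstar d Y₁ Y₂ V → Z₁ = resid d Y₁ W → Z₂ = resid d Y₂ W →
        IsG0 Z₁ (1 - Matrix.diagonal d) P ∧ IsG0 Z₂ (1 - Matrix.diagonal d) P ∧ IsG0 W 1 P ∧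
        iIndepFun ![Z₁, Z₂, W] P ∧
        (∀ ω, Y₁ ω = app (diagSqrt d) (W ω) + Z₁ ω) ∧
        (∀ ω, Y₂ ω = app (diagSqrt d) (W ω) + Z₂ ω) ∧
        HasIndepComponents V P ∧ HasIndepComponents Z₁ P ∧ HasIndepComponents Z₂ P ∧
        HasIndepComponents W P ∧
        IsG0 (fun ω => stack (stack (Y₁ ω) (Y₂ ω)) (W ω)) (Qs d 1) P ∧
        P.map (fun ω => stack (stack (Y₁ ω) (Y₂ ω)) (W ω)) ∈ Pci d ∧
        P.map (fun ω => stack (stack (Y₁ ω) (Y₂ ω)) (W ω)) ∈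
          PCIGmin (P.map (fun ω => stack (Y₁ ω) (Y₂ ω))) n ∧
        wynerC Y₁ Y₂ P = mutualInfo (fun ω => (Y₁ ω, Y₂ ω)) W P) ∧
    -- such a realization exists on some probability space
    (∃ (Ω' : Type) (_ : MeasurableSpace Ω') (P' : Measure Ω') (Y₁' Y₂' V' : Ω' → Vec (Fin n)),
      IsProbabilityMeasure P' ∧ IsCorrPair d Y₁' Y₂' P' ∧ IsExtraNoise Y₁' Y₂' V' P') := by
  have hd0 : ∀ i, 0 < d i := fun i => (hd i).1
  have hQ := hY.law.1
  have hν := hY.law.2.map_eq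
  have hC : wynerC Y₁ Y₂ P = ENNReal.ofReal (1 / 2 * ∑ i, Real.log ((1 + d i) / (1 - d i))) := by
    rw [wynerC, hν, wynerCLaw_eq hd hQ]
  have hmin : Pci d ⊆ PCIGmin (P.map (fun ω => stack (Y₁ ω) (Y₂ ω))) n := by
    rw [hν]
    exact Pci_subset_PCIGmin hd hQ
  have h1 := one_mem_QWset hd
  refine ⟨⟨hC, ?_, ?_, ?_⟩, ⟨hmin, h1, ?_, fun Q hQ hne => tripleInfo_gaussQs_one_lt hd hQ hne⟩,
    ⟨?_, ?_⟩, ?_, ?_⟩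
  · rw [hC]
    congr 2
    refine Finset.sum_congr rfl fun i _ => ?_
    congr 1
    have : 1 - d i ≠ 0 := by linarith [hd i]
    field_simp
    ring
  · rw [hC, ENNReal.ofReal_pos]
    refine mul_pos (by norm_num) (Finset.sum_pos (fun i _ => Real.log_pos ?_) ⟨⟨0, hn⟩, by simp⟩)
    rw [one_lt_div] <;> linarith [hd i]
  · rw [hC]
    exact ENNReal.ofReal_lt_top
  · rw [hC, tripleInfo_gaussQs_one hd]
  · rw [L12_eq hd0]
    exact Matrix.isDiag_diagonal _
  · rw [L3_eq hd0]
    exact Matrix.isDiag_diagonal _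
  · rintro V hV W Z₁ Z₂ hW rfl rfl
    have hYW := isG0_Wstar hd hY hV
    have hY₁ := hY.meas₁
    have hY₂ := hY.meas₂
    have hVm := hV.meas
    have hWm : Measurable W := by
      rw [hW]; unfold Wstar; simp only [app_eq_mulVecE]; fun_prop
    rw [← hW] at hYW
    have hN : IsG0 (fun ω => stack (stack (resid d Y₁ W ω) (resid d Y₂ W ω)) (W ω)) _ P :=
      isG0_noise_one hd hYW
    have hZ₁ := hN.fst.fst
    have hZ₂ := hN.fst.snd
    have hdiag : 1 - Matrix.diagonal d = Matrix.diagonal fun i => 1 - d i := by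
      rw [← Matrix.diagonal_one, Matrix.diagonal_sub]
    have hZ₁' := hdiag ▸ hZ₁
    have hZ₂' := hdiag ▸ hZ₂
    have hW' : IsG0 W (Matrix.diagonal fun _ => 1) P := by
      rw [Matrix.diagonal_one]; exact hN.snd
    have hV' : IsG0 V (Matrix.diagonal fun _ => 1) P := by
      rw [Matrix.diagonal_one]; exact hV.law
    have hmem : P.map (fun ω => stack (stack (Y₁ ω) (Y₂ ω)) (W ω)) ∈ Pci d :=
      ⟨1, h1, hYW.2.map_eq⟩
    refine ⟨hZ₁, hZ₂, hN.snd, iIndepFun_three_of_isG0 hN, fun ω => ?_, fun ω => ?_,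
      hV'.iIndepFun_eval, hZ₁'.iIndepFun_eval, hZ₂'.iIndepFun_eval, hW'.iIndepFun_eval,
      hYW, hmem, hmin hmem, ?_⟩
    · simp [resid]
    · simp [resid]
    · have hst : Measurable fun ω => stack (Y₁ ω) (Y₂ ω) :=
        measurable_stack.comp (hY₁.prodMk hY₂)
      have e1 : mutualInfo (fun ω => (Y₁ ω, Y₂ ω)) W P =
          mutualInfo (fun ω => stack (Y₁ ω) (Y₂ ω)) W P := by
        refine le_antisymm ?_ ?_
        · exact mutualInfo_comp_left_le (T := fun y => (fstBlock y, sndBlock y)) hst.aemeasurable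
            hWm.aemeasurable (measurable_fstBlock.prodMk measurable_sndBlock)
        · exact mutualInfo_comp_left_le (hY₁.prodMk hY₂).aemeasurable hWm.aemeasurable
            measurable_stack
      have e2 := mutualInfo_map (P := P) (measurable_stack.comp (hst.prodMk hWm))
        (measurable_fstBlock (ι := Fin n ⊕ Fin n) (κ := Fin n)) measurable_sndBlock
      have e3 : P.map (fun ω => stack (stack (Y₁ ω) (Y₂ ω)) (W ω)) = gaussQs d 1 := hYW.2.map_eq
      rw [e1, hC, ← tripleInfo_gaussQs_one hd, ← e3]
      exact e2
  · refine ⟨Vec (Fin n ⊕ Fin n) × Vec (Fin n), inferInstance,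
      (multivariateGaussian 0 (Qcorr d)).prod (multivariateGaussian 0 1),
      fun p => fstBlock p.1, fun p => sndBlock p.1, Prod.snd, inferInstance,
      ⟨measurable_fstBlock.comp measurable_fst, measurable_sndBlock.comp measurable_fst, ?_⟩,
      ⟨measurable_snd, ?_, ?_⟩⟩
    · simp only [stack_fstBlock_sndBlock]
      exact ⟨hQ, measurable_fst.aemeasurable, Measure.fst_prod⟩
    · exact ⟨Matrix.PosSemidef.one, measurable_snd.aemeasurable, Measure.snd_prod⟩
    · have h : IndepFun Prod.fst Prod.snd ((multivariateGaussian 0 (Qcorr d)).prod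
          (multivariateGaussian (0 : Vec (Fin n)) 1)) := by
        rw [indepFun_iff_map_prod_eq_prod_map_map (by fun_prop) (by fun_prop)]
        change Measure.map id _ = Measure.prod (Measure.fst _) (Measure.snd _)
        rw [Measure.map_id, Measure.fst_prod, Measure.snd_prod]
      refine indep_of_indep_of_le_right h.symm (sup_le ?_ ?_)
      · exact (measurable_fstBlock.comp (comap_measurable Prod.fst)).comap_le
      · exact (measurable_sndBlock.comp (comap_measurable Prod.fst)).comap_le
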